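/- \textbf{Setting.} Let $d\ge 0$ be an integer, $E=\mathbb C^d$ with standard orthonormal basis $e_1,\dots,e_d$. A matrix $q\in M_d(\mathbb C)$ is \emph{admissible} if $q_{ii}=0$ for all $i$ and $0\ne q_{ij}=q_{ji}^{-1}$ for all $i\neq j$. For such $q$ let $X_q$ be the maximal standard subproduct system with $X_q(0)=\mathbb C$, $X_q(1)=E$ and $$X_q(2)=E\otimes E\ominus \operatorname{span}\{e_i\otimes e_j-q_{ij}\,e_j\otimes e_i : i\ne j\},$$ that is, $X_q(n)=\bigcap_{i+j=n,\ i,j\ge 1}X_q(i)\otimes X_q(j)\subseteq E^{\otimes n}$ for $n>2$. Let $\mathfrak F_{X_q}=\bigoplus_{n\ge 0}X_q(n)$ be its Fock space (Hilbert space direct sum), and let $S^q_i$ be the bounded operator on $\mathfrak F_{X_q}$ with $S^q_i x=p_{n+1}(e_i\otimes x)$ for $x\in X_q(n)$, where $p_{n+1}$ is the orthogonal projection of $E^{\otimes (n+1)}$ onto $X_q(n+1)$. Let $\mathcal A_q\subseteq B(\mathfrak F_{X_q})$ be the norm-closed unital algebra generated by $S^q_1,\dots,S^q_d$. For $\sigma\in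 S_d$ let $U_\sigma$ be the permutation matrix with $U_\sigma e_j=e_{\sigma(j)}$. An isometric isomorphism is a (surjective) isometric isomorphism of algebras. \textbf{Theorem.} Let $q$ and $r$ be admissible $d\times d$ matrices with $q_{ij}\neq 1$ and $r_{ij}\ne 1$ for all $i\neq j$. (1) $\mathcal A_q$ is isometrically isomorphic to $\mathcal A_r$ if and only if $r=U_\sigma qU_\sigma^{-1}$ for some permutation $\sigma\in S_d$. (2) If $d\neq 1$, then for every isometric isomorphism $\varphi:\mathcal A_q\to\mathcal A_r$ there are $\sigma\in S_d$ with $r=U_\sigma qU_\sigma^{-1}$ and $\lambda_1,\dots,\lambda_d\in\mathbb C$ with $|\lambda_i|=1$ such that $\varphi(S^q_i)=\lambda_iS^r_{\sigma(i)}$ for all $i$. (3) Conversely, for every $\sigma\in S_d$ with $r=U_\sigma qU_\sigma^{-1}$ and all $\lambda_1,\dots,\lambda_d\in\mathbb C$ with $|\lambda_i|=1$ there is exactly one isometric isomorphism $\varphi:\mathcal A_q\to\mathcal A_r$ with $\varphi(S^q_i)=\lambda_iS^r_{\sigma(i)}$ for all $i$. Moreover, for $d=2$ write $\mathcal A_q$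 ($q\in\mathbb C\setminus\{0\}$) for the algebra of the admissible matrix $\begin{pmatrix}0&q\\q^{-1}&0\end{pmatrix}$. Then for all $q,r\in\mathbb C\setminus\{0\}$ (the value $1$ included), $\mathcal A_q$ is isometrically isomorphic to $\mathcal A_r$ if and only if $r=q$ or $r=q^{-1}$. -/

import Mathlib

noncomputable section

namespace QCommuting

/-- The tensor power `E^{⊗n}` of the Hilbert space `E = ℂ^d`, in the coordinates of its standard
orthonormal basis `e_α = e_{α₁} ⊗ ⋯ ⊗ e_{αₙ}`, where `α` runs over the words of length `n` in
`{1, …, d}`. -/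
abbrev TPow (d n : ℕ) : Type := EuclideanSpace ℂ (Fin n → Fin d)

/-- The standard basis vector `e_i` of `E = E^{⊗1}`. -/
def e {d : ℕ} (i : Fin d) : TPow d 1 := EuclideanSpace.single (fun _ => i) 1

/-- The tensor product `x ⊗ y ∈ E^{⊗k}` of `x ∈ E^{⊗m}` and `y ∈ E^{⊗n}`, where `m + n = k`:
it is the bilinear map with `e_α ⊗ e_β = e_{αβ}` (concatenation of words). -/
def tmul {d m n k : ℕ} (h : m + n = k) (x : TPow d m) (y : TPow d n) : TPow d k :=
  WithLp.toLp 2 fun w =>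
    x (fun i => w (Fin.cast h (Fin.castAdd n i))) * y (fun j => w (Fin.cast h (Fin.natAdd m j)))

/-- The subspace `A ⊗ B` of `E^{⊗k} = E^{⊗m} ⊗ E^{⊗n}`. -/
def tensorSub {d m n k : ℕ} (h : m + n = k) (A : Submodule ℂ (TPow d m))
    (B : Submodule ℂ (TPow d n)) : Submodule ℂ (TPow d k) :=
  Submodule.span ℂ {z | ∃ x ∈ A, ∃ y ∈ B, z = tmul h x y}

/-- A standard subproduct system of Hilbert spaces over `ℕ` with `X(0) = ℂ`, `X(1) = E = ℂ^d`:
subspaces `X(n) ⊆ E^{⊗n}` with `X(m+n) ⊆ X(m) ⊗ X(n)`.  Its multiplication maps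
`X(m) ⊗ X(n) → X(m+n)` are the restrictions of the orthogonal projections onto `X(m+n)`. -/
structure StandardSubproductSystem (d : ℕ) where
  fiber : ∀ n : ℕ, Submodule ℂ (TPow d n)
  fiber_zero : fiber 0 = ⊤
  fiber_one : fiber 1 = ⊤
  fiber_add : ∀ {m n k : ℕ} (h : m + n = k), fiber k ≤ tensorSub h (fiber m) (fiber n)

/-- The fibers of the maximal standard subproduct system with prescribed fibers
`X(1) = E`, `X(2) = X₂`:  inductively `X(n) = ⋂_{i+j=n, i,j ≥ 1} X(i) ⊗ X(j)` for `n > 2`. -/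
def maxFiber {d : ℕ} (X₂ : Submodule ℂ (TPow d 2)) : ∀ n : ℕ, Submodule ℂ (TPow d n)
  | 0 => ⊤
  | 1 => ⊤
  | 2 => X₂
  | n + 3 => ⨅ (i : ℕ) (j : ℕ) (h : (i + 1) + (j + 1) = n + 3),
      tensorSub h (maxFiber X₂ (i + 1)) (maxFiber X₂ (j + 1))
  termination_by n => n
  decreasing_by all_goals omega

theorem norm_tmul {d m n k : ℕ} (h : m + n = k) (x : TPow d m) (y : TPow d n) :
    ‖tmul h x y‖ = ‖x‖ * ‖y‖ := by
  subst h
  rw [← sq_eq_sq₀ (norm_nonneg _) (by positivity), mul_pow, EuclideanSpace.norm_sq_eq,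
    EuclideanSpace.norm_sq_eq, EuclideanSpace.norm_sq_eq, Finset.sum_mul_sum,
    ← Fintype.sum_prod_type',
    ← (Fin.appendEquiv (α := Fin d) m n).sum_comp]
  refine Finset.sum_congr rfl fun p _ => ?_
  simp [tmul, Fin.appendEquiv, mul_pow]

theorem tmul_add {d m n k : ℕ} (h : m + n = k) (x : TPow d m) (y z : TPow d n) :
    tmul h x (y + z) = tmul h x y + tmul h x z := by
  ext w; simp [tmul, mul_add]

theorem tmul_smul {d m n k : ℕ} (h : m + n = k) (x : TPow d m) (c : ℂ) (y : TPow d n) :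
    tmul h x (c • y) = c • tmul h x y := by
  ext w; simp [tmul]; ring

theorem tensorSub_top_eq {d : ℕ} (h : 1 + 1 = 2) :
    tensorSub h (⊤ : Submodule ℂ (TPow d 1)) (⊤ : Submodule ℂ (TPow d 1)) = ⊤ := by
  rw [eq_top_iff]
  intro x _
  rw [← (EuclideanSpace.basisFun (Fin 2 → Fin d) ℂ).sum_repr x]
  refine Submodule.sum_mem _ fun w _ => Submodule.smul_mem _ _ (Submodule.subset_span ?_)
  refine ⟨e (w 0), trivial, e (w 1), trivial, ?_⟩
  ext v
  have h0 : ∀ (a b : Fin 1 → Fin d), a = b ↔ a 0 = b 0 := fun a b =>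
    ⟨fun h => by rw [h], fun h => funext fun i => by rw [Subsingleton.elim i 0]; exact h⟩
  have hv : v = w ↔ v 0 = w 0 ∧ v 1 = w 1 :=
    ⟨fun h => by simp [h], fun h => funext fun i => by fin_cases i; exacts [h.1, h.2]⟩
  have c0 : Fin.cast h (Fin.castAdd 1 (0 : Fin 1)) = 0 := rfl
  have c1 : Fin.cast h (Fin.natAdd 1 (0 : Fin 1)) = 1 := rfl
  simp only [EuclideanSpace.basisFun_apply, tmul, e, PiLp.single_apply, h0, hv, c0, c1]
  by_cases h1 : v 0 = w 0 <;> by_cases h2 : v 1 = w 1 <;> simp [h1, h2]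

theorem le_tensorSub_zero_left {d n k : ℕ} (h : 0 + n = k) (X : ∀ n, Submodule ℂ (TPow d n))
    (h0 : X 0 = ⊤) : X k ≤ tensorSub h (X 0) (X n) := by
  obtain rfl : n = k := by omega
  intro x hx
  refine Submodule.subset_span ⟨EuclideanSpace.single (fun i => i.elim0) 1, h0 ▸ trivial, x, hx, ?_⟩
  ext w
  have : ∀ a b : Fin 0 → Fin d, a = b := fun a b => Subsingleton.elim a b
  have h2 : (fun j => w (Fin.cast h (Fin.natAdd 0 j))) = w :=
    funext fun j => congrArg w (Fin.ext (by simp))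
  simp only [tmul, h2, PiLp.single_apply]
  rw [if_pos (this _ _), one_mul]

theorem le_tensorSub_zero_right {d m k : ℕ} (h : m + 0 = k) (X : ∀ n, Submodule ℂ (TPow d n))
    (h0 : X 0 = ⊤) : X k ≤ tensorSub h (X m) (X 0) := by
  obtain rfl : m = k := by omega
  intro x hx
  refine Submodule.subset_span ⟨x, hx, EuclideanSpace.single (fun i => i.elim0) 1, h0 ▸ trivial, ?_⟩
  ext w
  have : ∀ a b : Fin 0 → Fin d, a = b := fun a b => Subsingleton.elim a b
  have h2 : (fun j => w (Fin.cast h (Fin.castAdd 0 j))) = w :=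
    funext fun j => congrArg w (Fin.ext (by simp))
  simp only [tmul, h2, PiLp.single_apply]
  rw [if_pos (this _ _), mul_one]

/-- The maximal standard subproduct system with prescribed fibers `X(1) = E`, `X(2) = X₂`. -/
def maxStandard {d : ℕ} (X₂ : Submodule ℂ (TPow d 2)) : StandardSubproductSystem d where
  fiber := maxFiber X₂
  fiber_zero := by rw [maxFiber]
  fiber_one := by rw [maxFiber]
  fiber_add := by
    intro m n k h
    have h0 : maxFiber X₂ 0 = ⊤ := by rw [maxFiber]
    rcases m with _ | m
    · exact le_tensorSub_zero_left h _ h0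
    rcases n with _ | n
    · exact le_tensorSub_zero_right h _ h0
    obtain _ | _ | _ | k := k
    · omega
    · omega
    · obtain rfl : m = 0 := by omega
      obtain rfl : n = 0 := by omega
      have h1 : maxFiber X₂ (0 + 1) = ⊤ := by rw [maxFiber]
      rw [h1]
      exact (tensorSub_top_eq (d := d) h).symm ▸ le_top
    · rw [maxFiber]
      exact iInf_le_of_le m (iInf_le_of_le n (iInf_le_of_le h le_rfl))

namespace StandardSubproductSystem

variable {d : ℕ} (X : StandardSubproductSystem d)

/-- The `X`-Fock space `𝔉_X = ⨁_n X(n)` (Hilbert space direct sum). -/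
abbrev Fock : Type := lp (fun n => X.fiber n) 2

instance : NormedAddCommGroup X.Fock := lp.normedAddCommGroup

instance : InnerProductSpace ℂ X.Fock := inferInstance

instance : SeminormedAddCommGroup X.Fock := inferInstance

instance : NormedSpace ℂ X.Fock := inferInstance

instance : IsTopologicalAddGroup X.Fock := SeminormedAddCommGroup.toIsTopologicalAddGroup

instance : NormedRing (X.Fock →L[ℂ] X.Fock) := ContinuousLinearMap.toNormedRing

instance : NormedAlgebra ℂ (X.Fock →L[ℂ] X.Fock) := ContinuousLinearMap.toNormedAlgebra

/-- The sequence `S^X_i x` for `x ∈ 𝔉_X`:  its component in `X(n+1)` is the orthogonal projection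
onto `X(n+1)` of `e_i ⊗ xₙ`, and its component in `X(0)` vanishes. -/
def shiftFun (i : Fin d) (x : X.Fock) : ∀ n : ℕ, X.fiber n
  | 0 => 0
  | n + 1 => (X.fiber (n + 1)).orthogonalProjectionOnto
      (tmul (Nat.add_comm 1 n) (e i) (x n : TPow d n))

theorem norm_shiftFun_le (i : Fin d) (x : X.Fock) (n : ℕ) :
    ‖X.shiftFun i x (n + 1)‖ ≤ ‖x n‖ := by
  refine (Submodule.norm_orthogonalProjectionOnto_apply_le (X.fiber (n + 1))
    (tmul (Nat.add_comm 1 n) (e i) (x n : TPow d n))).trans ?_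
  rw [norm_tmul]
  simp [e]

theorem summable_shiftFun (i : Fin d) (x : X.Fock) :
    Summable fun n => ‖X.shiftFun i x n‖ ^ 2 := by
  have hx : Summable fun n => ‖x n‖ ^ 2 := by
    simpa using (lp.memℓp x).summable (by norm_num)
  rw [← summable_nat_add_iff 1]
  exact Summable.of_nonneg_of_le (fun n => by positivity)
    (fun n => pow_le_pow_left₀ (norm_nonneg _) (X.norm_shiftFun_le i x n) 2) hx

theorem memℓp_shiftFun (i : Fin d) (x : X.Fock) : Memℓp (X.shiftFun i x) 2 :=
  memℓp_gen (by simpa using X.summable_shiftFun i x)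

theorem norm_sq_eq_tsum (x : X.Fock) : ‖x‖ ^ 2 = ∑' n, ‖x n‖ ^ 2 := by
  have := lp.norm_rpow_eq_tsum (p := 2) (by norm_num) x
  simpa using this

/-- The component `S^X_i` of the standard `X`-shift, a bounded operator on `𝔉_X`. -/
def shift (i : Fin d) : X.Fock →L[ℂ] X.Fock :=
  LinearMap.mkContinuous
    { toFun := fun x => ⟨X.shiftFun i x, X.memℓp_shiftFun i x⟩
      map_add' := fun x y => by
        refine lp.ext (funext fun n => ?_)
        change X.shiftFun i (x + y) n = X.shiftFun i x n + X.shiftFun i y n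
        cases n <;> simp [shiftFun, tmul_add]
      map_smul' := fun c x => by
        refine lp.ext (funext fun n => ?_)
        change X.shiftFun i (c • x) n = c • X.shiftFun i x n
        cases n <;> simp [shiftFun, tmul_smul] }
    1 fun x => by
      change ‖(⟨X.shiftFun i x, X.memℓp_shiftFun i x⟩ : X.Fock)‖ ≤ _
      have hx : Summable fun n => ‖x n‖ ^ 2 := by
        simpa using (lp.memℓp x).summable (by norm_num)
      rw [one_mul, ← sq_le_sq₀ (norm_nonneg _) (norm_nonneg _), norm_sq_eq_tsum, norm_sq_eq_tsum]
      change ∑' n, ‖X.shiftFun i x n‖ ^ 2 ≤ _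
      have hs := X.summable_shiftFun i x
      rw [hs.tsum_eq_zero_add]
      have h0 : ‖X.shiftFun i x 0‖ ^ 2 = 0 := by simp [shiftFun]
      rw [h0, zero_add]
      exact Summable.tsum_le_tsum
        (fun n => pow_le_pow_left₀ (norm_nonneg _) (X.norm_shiftFun_le i x n) 2)
        ((summable_nat_add_iff 1).2 hs) hx

/-- The algebra `𝒜_X`: the norm-closed unital algebra of operators on `𝔉_X` generated by the
standard `X`-shift `S^X_1, …, S^X_d`. -/
def alg : Subalgebra ℂ (X.Fock →L[ℂ] X.Fock) :=
  (Algebra.adjoin ℂ (Set.range X.shift)).topologicalClosure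

theorem shift_mem_alg (i : Fin d) : X.shift i ∈ X.alg :=
  Subalgebra.le_topologicalClosure _ (Algebra.subset_adjoin ⟨i, rfl⟩)

end StandardSubproductSystem

/-- Admissible matrices: `q_ii = 0` and `0 ≠ q_ij = q_ji⁻¹` for `i ≠ j`. -/
def Admissible {d : ℕ} (q : Matrix (Fin d) (Fin d) ℂ) : Prop :=
  (∀ i, q i i = 0) ∧ ∀ i j, i ≠ j → q i j ≠ 0 ∧ q i j = (q j i)⁻¹

/-- `X_q(2) = E ⊗ E ⊖ span {e_i ⊗ e_j - q_ij e_j ⊗ e_i : i ≠ j}`. -/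
def qFiberTwo {d : ℕ} (q : Matrix (Fin d) (Fin d) ℂ) : Submodule ℂ (TPow d 2) :=
  (Submodule.span ℂ {z : TPow d 2 | ∃ i j : Fin d, i ≠ j ∧
    z = tmul (Nat.one_add 1) (e i) (e j) - q i j • tmul (Nat.one_add 1) (e j) (e i)})ᗮ

/-- The subproduct system `X_q`. -/
def qSystem {d : ℕ} (q : Matrix (Fin d) (Fin d) ℂ) : StandardSubproductSystem d :=
  maxStandard (qFiberTwo q)

/-- The algebra `𝒜_q`. -/
abbrev qAlg {d : ℕ} (q : Matrix (Fin d) (Fin d) ℂ) :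
    Subalgebra ℂ ((qSystem q).Fock →L[ℂ] (qSystem q).Fock) :=
  (qSystem q).alg

/-- The generator `S^q_i` of `𝒜_q`. -/
def qShift {d : ℕ} (q : Matrix (Fin d) (Fin d) ℂ) (i : Fin d) : qAlg q :=
  ⟨(qSystem q).shift i, (qSystem q).shift_mem_alg i⟩

/-- `𝒜_q` and `𝒜_r` are isometrically isomorphic. -/
def IsometricallyIsomorphic {d : ℕ} (q r : Matrix (Fin d) (Fin d) ℂ) : Prop :=
  ∃ φ : qAlg q ≃ₐ[ℂ] qAlg r, Isometry φ

/-- The permutation matrix `U_σ`, with `U_σ e_j = e_{σ(j)}`. -/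
def permU {d : ℕ} (σ : Equiv.Perm (Fin d)) : Matrix (Fin d) (Fin d) ℂ :=
  Matrix.of fun i j => if i = σ j then 1 else 0

end QCommuting

end

/-!
Write `Ω` for the vacuum vector, `S_i` for the shifts, and suppose that all `q_ij, r_ij ≠ 1`.

*Axes.* Since `e_k^{⊗n} ∈ X_q(n)`, the coefficients `⟨e_k^{⊗n}, T Ω⟩` define a homomorphism
`axisHom k` from `𝒜_q` to the formal power series, with `S_k ↦ X` and `S_i ↦ 0` for `i ≠ k`. The
relation `S_i S_j = q_ij S_j S_i` (`qShift_mul_qShift`) and `q_ij ≠ 1` force every homomorphism to a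
commutative domain to kill all but one of the `S_i` (`algHom_mul_eq_zero`). Hence the characters
live on the closed unit discs of the axes, and an element that vanishes on all axes is killed by
every character (`character_eq_zero`).

*Vacuum.* The axes meet only in the vacuum state. If `d ≠ 1`, an isomorphism `φ` preserves it
(`constantCoeff_algEquiv_qShift`): otherwise some `φ(S_i)` vanishes on no axis, so all other
`φ(S_j)` vanish on every axis, although a character separates `S_j` from `0`.

*Rigidity.* The coefficients of degree one are derivations at the vacuum state, so an isometric `φ`
and its inverse have linear parts that are inverse matrices (`coeff_algEquiv`), with entries of
modulus at most one. Each row has only one nonzero entry, which is therefore unimodular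
(`exists_norm_coeff_one_eq_one`). Then `φ(S_i) Ω` has norm at most one and a unimodular component
`λ` along some `e_k`, so it equals `λ e_k = λ S_k Ω`. The algebra commutes with the right shifts,
for which `Ω` is cyclic, so `Ω` is separating (`eq_zero_of_apply_vacuum_eq_zero`) and
`φ(S_i) = λ S_k`. Comparison of the relations gives `r_{σ(i)σ(j)} = q_ij`
(`exists_perm_of_isometry`).

*Existence.* A permutation that matches `q` with `r`, together with unimodular weights, acts on
words by unitaries that map `X_q(n)` onto `X_r(n)` and intertwine the shifts; conjugation by the
resulting unitary of the Fock spaces is the required isomorphism (`exists_isometry_of_perm`).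

For `d = 2` the parameter `1` is exactly the case of a commutative algebra.
-/

noncomputable section

namespace QCommuting

open Filter Topology

/-! ### Tensor products of homogeneous vectors -/

theorem inner_tmul {d m n k : ℕ} (h : m + n = k) (x x' : TPow d m) (y y' : TPow d n) :
    inner ℂ (tmul h x y) (tmul h x' y') = inner ℂ x x' * inner ℂ y y' := by
  subst h
  simp only [PiLp.inner_apply]
  rw [Finset.sum_mul_sum, ← Fintype.sum_prod_type', ← (Fin.appendEquiv (α := Fin d) m n).sum_comp]
  refine Finset.sum_congr rfl fun p _ => ?_
  simp [tmul, Fin.appendEquiv]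
  ring

theorem add_tmul {d m n k : ℕ} (h : m + n = k) (x y : TPow d m) (z : TPow d n) :
    tmul h (x + y) z = tmul h x z + tmul h y z := by
  ext w; simp [tmul, add_mul]

theorem smul_tmul {d m n k : ℕ} (h : m + n = k) (c : ℂ) (x : TPow d m) (y : TPow d n) :
    tmul h (c • x) y = c • tmul h x y := by
  ext w; simp [tmul]; ring

theorem sub_tmul {d m n k : ℕ} (h : m + n = k) (x y : TPow d m) (z : TPow d n) :
    tmul h (x - y) z = tmul h x z - tmul h y z := by
  ext w; simp [tmul, sub_mul]

theorem tmul_sub {d m n k : ℕ} (h : m + n = k) (x : TPow d m) (y z : TPow d n) :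
    tmul h x (y - z) = tmul h x y - tmul h x z := by
  ext w; simp [tmul, mul_sub]

/-- Concatenation of words is associative. -/
theorem tmul_assoc {d a b c m n k : ℕ} (h₁ : a + b = m) (h₂ : m + c = k) (h₃ : b + c = n)
    (h₄ : a + n = k) (x : TPow d a) (y : TPow d b) (z : TPow d c) :
    tmul h₂ (tmul h₁ x y) z = tmul h₄ x (tmul h₃ y z) := by
  subst h₁ h₂ h₃
  ext w
  simp only [tmul, mul_assoc]
  refine congrArg₂ _ rfl (congrArg₂ _ (congrArg _ (funext fun i => congrArg w (Fin.ext ?_)))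
    (congrArg _ (funext fun i => congrArg w (Fin.ext ?_))))
  · simp
  · simp [add_assoc]

theorem inner_eq_zero_of_mem_tensorSub_right {d m n k : ℕ} {h : m + n = k}
    {A : Submodule ℂ (TPow d m)} {B : Submodule ℂ (TPow d n)} {z : TPow d k}
    (hz : z ∈ tensorSub h A B) (x : TPow d m) {y : TPow d n} (hy : y ∈ Bᗮ) :
    inner ℂ z (tmul h x y) = 0 := by
  induction hz using Submodule.span_induction with
  | mem z hz =>
    obtain ⟨a, -, b, hb, rfl⟩ := hz
    rw [inner_tmul, (Submodule.mem_orthogonal B y).1 hy b hb, mul_zero]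
  | zero => simp
  | add u v _ _ hu hv => rw [inner_add_left, hu, hv, add_zero]
  | smul c u _ hu => rw [inner_smul_left, hu, mul_zero]

theorem inner_eq_zero_of_mem_tensorSub_left {d m n k : ℕ} {h : m + n = k}
    {A : Submodule ℂ (TPow d m)} {B : Submodule ℂ (TPow d n)} {z : TPow d k}
    (hz : z ∈ tensorSub h A B) {x : TPow d m} (hx : x ∈ Aᗮ) (y : TPow d n) :
    inner ℂ z (tmul h x y) = 0 := by
  induction hz using Submodule.span_induction with
  | mem z hz =>
    obtain ⟨a, ha, b, -, rfl⟩ := hz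
    rw [inner_tmul, (Submodule.mem_orthogonal A x).1 hx a ha, zero_mul]
  | zero => simp
  | add u v _ _ hu hv => rw [inner_add_left, hu, hv, add_zero]
  | smul c u _ hu => rw [inner_smul_left, hu, mul_zero]

/-- Projections of two vectors onto a subspace agree once the difference is orthogonal to it. -/
theorem orthogonalProjectionOnto_eq_of_inner {E : Type*} [NormedAddCommGroup E]
    [InnerProductSpace ℂ E] (K : Submodule ℂ E) [K.HasOrthogonalProjection] {x y : E}
    (h : ∀ z ∈ K, inner ℂ z (x - y) = 0) :
    K.orthogonalProjectionOnto x = K.orthogonalProjectionOnto y := by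
  rw [← sub_eq_zero, ← map_sub, Submodule.orthogonalProjectionOnto_eq_zero_iff]
  exact (Submodule.mem_orthogonal _ _).2 h

namespace StandardSubproductSystem

variable {d : ℕ} (X : StandardSubproductSystem d)

/-- Subproduct associativity on the right factor: projecting the right factor onto its fiber
first does not change the projection of a tensor. -/
theorem proj_tmul_proj_right {m n k : ℕ} (h : m + n = k) (x : TPow d m) (y : TPow d n) :
    (X.fiber k).orthogonalProjectionOnto
      (tmul h x ((X.fiber n).orthogonalProjectionOnto y : TPow d n)) =
    (X.fiber k).orthogonalProjectionOnto (tmul h x y) := by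
  refine orthogonalProjectionOnto_eq_of_inner _ fun z hz => ?_
  rw [← tmul_sub]
  refine inner_eq_zero_of_mem_tensorSub_right (X.fiber_add h hz) x ?_
  rw [← neg_sub]
  exact Submodule.neg_mem _ (Submodule.sub_starProjection_mem_orthogonal (K := X.fiber n) y)

/-- Subproduct associativity on the left factor. -/
theorem proj_tmul_proj_left {m n k : ℕ} (h : m + n = k) (x : TPow d m) (y : TPow d n) :
    (X.fiber k).orthogonalProjectionOnto
      (tmul h ((X.fiber m).orthogonalProjectionOnto x : TPow d m) y) =
    (X.fiber k).orthogonalProjectionOnto (tmul h x y) := by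
  refine orthogonalProjectionOnto_eq_of_inner _ fun z hz => ?_
  rw [← sub_tmul]
  refine inner_eq_zero_of_mem_tensorSub_left (X.fiber_add h hz) ?_ y
  rw [← neg_sub]
  exact Submodule.neg_mem _ (Submodule.sub_starProjection_mem_orthogonal (K := X.fiber m) x)

@[simp]
theorem shift_apply_zero (i : Fin d) (x : X.Fock) : X.shift i x 0 = 0 := rfl

theorem shift_apply_succ (i : Fin d) (x : X.Fock) (n : ℕ) :
    X.shift i x (n + 1) = (X.fiber (n + 1)).orthogonalProjectionOnto
      (tmul (Nat.add_comm 1 n) (e i) (x n : TPow d n)) := rfl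

theorem norm_shift_le (i : Fin d) : ‖X.shift i‖ ≤ 1 :=
  LinearMap.mkContinuous_norm_le _ zero_le_one _

/-! ### The vacuum vector is separating for the algebra -/

/-- The vacuum vector `Ω`, the unit vector `1 ∈ ℂ = X(0)`. -/
def vacuum : X.Fock :=
  lp.single 2 0 ⟨EuclideanSpace.single (fun i => i.elim0) 1, X.fiber_zero ▸ trivial⟩

theorem vacuum_apply_zero (w : Fin 0 → Fin d) : (X.vacuum 0 : TPow d 0) w = 1 := by
  rw [vacuum, lp.single_apply_self]
  simp [PiLp.single_apply, Subsingleton.elim w (fun i => i.elim0)]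

theorem vacuum_apply_succ (n : ℕ) : X.vacuum (n + 1) = 0 := by
  rw [vacuum, lp.single_apply_ne _ _ _ (Nat.succ_ne_zero n)]

theorem norm_vacuum : ‖X.vacuum‖ = 1 := by
  rw [vacuum, lp.norm_single (by norm_num)]
  simp

theorem add_apply (S T : X.alg) (x : X.Fock) : ((S + T : X.alg) : X.Fock →L[ℂ] X.Fock) x =
    (S : X.Fock →L[ℂ] X.Fock) x + (T : X.Fock →L[ℂ] X.Fock) x := rfl

theorem mul_apply (S T : X.alg) (x : X.Fock) : ((S * T : X.alg) : X.Fock →L[ℂ] X.Fock) x =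
    (S : X.Fock →L[ℂ] X.Fock) ((T : X.Fock →L[ℂ] X.Fock) x) := rfl

theorem smul_apply (c : ℂ) (T : X.alg) (x : X.Fock) : ((c • T : X.alg) : X.Fock →L[ℂ] X.Fock) x =
    c • (T : X.Fock →L[ℂ] X.Fock) x := rfl

theorem algebraMap_apply (c : ℂ) (x : X.Fock) :
    ((algebraMap ℂ X.alg c : X.alg) : X.Fock →L[ℂ] X.Fock) x = c • x := rfl

/-- Induction over `𝒜_X`: a closed property that holds for the scalars and the shifts and is
stable under sums and products holds on `𝒜_X`. -/
theorem alg_induction {P : X.alg → Prop} (hclosed : IsClosed {T | P T})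
    (hshift : ∀ i, P ⟨X.shift i, X.shift_mem_alg i⟩) (hconst : ∀ c : ℂ, P (algebraMap ℂ X.alg c))
    (hadd : ∀ S T, P S → P T → P (S + T)) (hmul : ∀ S T, P S → P T → P (S * T)) (T : X.alg) :
    P T := by
  have key : ∀ (S : X.Fock →L[ℂ] X.Fock) (hS : S ∈ Algebra.adjoin ℂ (Set.range X.shift)),
      P ⟨S, Subalgebra.le_topologicalClosure _ hS⟩ := by
    intro S hS
    induction hS using Algebra.adjoin_induction with
    | mem S hS => obtain ⟨i, rfl⟩ := hS; exact hshift i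
    | algebraMap c => exact hconst c
    | add S T _ _ h₁ h₂ => exact hadd _ _ h₁ h₂
    | mul S T _ _ h₁ h₂ => exact hmul _ _ h₁ h₂
  have hT : (T : X.Fock →L[ℂ] X.Fock) ∈ closure (Algebra.adjoin ℂ (Set.range X.shift) : Set _) :=
    T.2
  obtain ⟨u, hu, hlim⟩ := mem_closure_iff_seq_limit.1 hT
  refine hclosed.mem_of_tendsto (b := atTop)
    (f := fun n => (⟨u n, Subalgebra.le_topologicalClosure _ (hu n)⟩ : X.alg)) ?_
    (Eventually.of_forall fun n => key _ (hu n))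
  exact tendsto_subtype_rng.2 hlim

theorem continuous_coeff (x : X.Fock) (n : ℕ) (w : Fin n → Fin d) :
    Continuous fun T : X.alg => ((T : X.Fock →L[ℂ] X.Fock) x n : TPow d n) w := by
  have h1 : Continuous fun T : X.alg => (T : X.Fock →L[ℂ] X.Fock) x :=
    (ContinuousLinearMap.apply ℂ X.Fock x).continuous.comp continuous_subtype_val
  have h2 : Continuous fun y : X.Fock => y n := (lp.lipschitzWith_one_eval 2 n).continuous
  exact (PiLp.continuous_apply 2 _ w).comp (continuous_subtype_val.comp (h2.comp h1))

/-- Right multiplication by `e_j`, the map `X(n) → X(n+1)` that sends `x` to the projection of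
`x ⊗ e_j`. -/
def rightMul (j : Fin d) (n : ℕ) : X.fiber n →ₗ[ℂ] X.fiber (n + 1) where
  toFun x := (X.fiber (n + 1)).orthogonalProjectionOnto (tmul rfl (x : TPow d n) (e j))
  map_add' x y := by rw [Submodule.coe_add, add_tmul, map_add]
  map_smul' c x := by rw [Submodule.coe_smul, smul_tmul, map_smul, RingHom.id_apply]

theorem rightMul_apply (j : Fin d) (n : ℕ) (x : X.fiber n) :
    X.rightMul j n x =
      (X.fiber (n + 1)).orthogonalProjectionOnto (tmul rfl (x : TPow d n) (e j)) := rfl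

/-- `y` is the image of `x` under the right shift by `e_j`. Stating this as a relation avoids the
construction of the right shift as a bounded operator. -/
def IsRightShift (j : Fin d) (x y : X.Fock) : Prop :=
  y 0 = 0 ∧ ∀ n, y (n + 1) = X.rightMul j n (x n)

theorem isClosed_isRightShift (j : Fin d) :
    IsClosed {p : X.Fock × X.Fock | X.IsRightShift j p.1 p.2} := by
  have h1 : ∀ n, Continuous fun x : X.Fock => x n :=
    fun n => (lp.lipschitzWith_one_eval 2 n).continuous
  have h2 : ∀ n, Continuous (X.rightMul j n) :=
    fun n => (X.rightMul j n).continuous_of_finiteDimensional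
  have h3 : {p : X.Fock × X.Fock | X.IsRightShift j p.1 p.2} = {p | p.2 0 = 0} ∩
      ⋂ n, {p : X.Fock × X.Fock | p.2 (n + 1) = X.rightMul j n (p.1 n)} := by
    ext p
    simp [IsRightShift]
  rw [h3]
  exact (isClosed_eq ((h1 0).comp continuous_snd) continuous_const).inter
    (isClosed_iInter fun n => isClosed_eq ((h1 (n + 1)).comp continuous_snd)
      ((h2 n).comp ((h1 n).comp continuous_fst)))

variable {X} in
theorem IsRightShift.add {j : Fin d} {x y x' y' : X.Fock} (h : X.IsRightShift j x y)
    (h' : X.IsRightShift j x' y') : X.IsRightShift j (x + x') (y + y') :=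
  ⟨(congrArg₂ (· + ·) h.1 h'.1).trans (add_zero _), fun n =>
    (congrArg₂ (· + ·) (h.2 n) (h'.2 n)).trans (map_add (X.rightMul j n) _ _).symm⟩

variable {X} in
theorem IsRightShift.smul {j : Fin d} {x y : X.Fock} (c : ℂ) (h : X.IsRightShift j x y) :
    X.IsRightShift j (c • x) (c • y) :=
  ⟨(congrArg (c • ·) h.1).trans (smul_zero _), fun n =>
    (congrArg (c • ·) (h.2 n)).trans (map_smul (X.rightMul j n) _ _).symm⟩

variable {X} in
theorem IsRightShift.shift {j : Fin d} {x y : X.Fock} (h : X.IsRightShift j x y) (i : Fin d) :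
    X.IsRightShift j (X.shift i x) (X.shift i y) := by
  refine ⟨rfl, fun n => ?_⟩
  rw [shift_apply_succ]
  rcases n with _ | n
  · have hz : tmul (Nat.add_comm 1 0) (e i) (0 : TPow d 0) = (0 : TPow d 1) := by
      ext w; simp [tmul]
    rw [h.1, shift_apply_zero, map_zero, Submodule.coe_zero, hz, map_zero]
  · rw [h.2, shift_apply_succ, rightMul_apply, rightMul_apply, proj_tmul_proj_right,
      proj_tmul_proj_left,
      tmul_assoc (n := n + 1) (Nat.add_comm 1 n) rfl rfl (Nat.add_comm 1 (n + 1))]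

variable {X} in
/-- Operators of `𝒜_X` commute with the right shifts. -/
theorem IsRightShift.map {j : Fin d} {x y : X.Fock} (h : X.IsRightShift j x y) (T : X.alg) :
    X.IsRightShift j ((T : X.Fock →L[ℂ] X.Fock) x) ((T : X.Fock →L[ℂ] X.Fock) y) := by
  have h1 : ∀ x : X.Fock, Continuous fun T : X.alg => (T : X.Fock →L[ℂ] X.Fock) x := fun x =>
    (ContinuousLinearMap.apply ℂ X.Fock x).continuous.comp continuous_subtype_val
  have key := X.alg_induction (P := fun T : X.alg => ∀ p : {p : X.Fock × X.Fock //
    X.IsRightShift j p.1 p.2}, X.IsRightShift j ((T : X.Fock →L[ℂ] X.Fock) p.1.1)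
      ((T : X.Fock →L[ℂ] X.Fock) p.1.2)) ?_ ?_ ?_ ?_ ?_ T
  · exact key ⟨(x, y), h⟩
  · have h3 := isClosed_iInter fun p : {p : X.Fock × X.Fock // X.IsRightShift j p.1 p.2} =>
      (X.isClosed_isRightShift j).preimage ((h1 p.1.1).prodMk (h1 p.1.2))
    convert h3 using 1
    ext T
    simp
  · exact fun i p => p.2.shift i
  · intro c p
    rw [algebraMap_apply, algebraMap_apply]
    exact p.2.smul c
  · intro S T hS hT p
    rw [add_apply, add_apply]
    exact (hS p).add (hT p)
  · intro S T hS hT p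
    rw [mul_apply, mul_apply]
    exact hS ⟨((T : X.Fock →L[ℂ] X.Fock) p.1.1, (T : X.Fock →L[ℂ] X.Fock) p.1.2), hT p⟩

theorem isRightShift_single (j : Fin d) (n : ℕ) (x : X.fiber n) :
    X.IsRightShift j (lp.single 2 n x) (lp.single 2 (n + 1) (X.rightMul j n x)) := by
  refine ⟨lp.single_apply_ne _ _ _ (Nat.succ_ne_zero n).symm, fun m => ?_⟩
  by_cases hmn : m = n
  · subst hmn
    rw [lp.single_apply_self, lp.single_apply_self]
  · rw [lp.single_apply_ne _ _ _ (by omega), lp.single_apply_ne _ _ _ hmn, map_zero]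

/-- A vector of `E^{⊗(n+1)}` is a combination of the `e_α ⊗ e_j`. -/
theorem sum_single_tmul_e (n : ℕ) (x : TPow d (n + 1)) :
    x = ∑ w : Fin (n + 1) → Fin d, x w • tmul (rfl : n + 1 = n + 1)
      (EuclideanSpace.single (fun i => w (Fin.castSucc i)) 1) (e (w (Fin.last n))) := by
  conv_lhs => rw [← (EuclideanSpace.basisFun (Fin (n + 1) → Fin d) ℂ).sum_repr x]
  refine Finset.sum_congr rfl fun w _ => ?_
  rw [EuclideanSpace.basisFun_apply, EuclideanSpace.basisFun_repr]
  congr 1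
  ext v
  have hv : v = w ↔ ((fun i : Fin n => v (Fin.castSucc i)) = fun i => w (Fin.castSucc i)) ∧
      (fun _ : Fin 1 => v (Fin.last n)) = fun _ => w (Fin.last n) := by
    refine ⟨by rintro rfl; simp, fun ⟨h1, h2⟩ => funext fun i => ?_⟩
    induction i using Fin.lastCases with
    | last => exact congrFun h2 0
    | cast i => exact congrFun h1 i
  have c0 : ∀ i : Fin n, Fin.cast (rfl : n + 1 = n + 1) (Fin.castAdd 1 i) = Fin.castSucc i :=
    fun _ => rfl
  have c1 : ∀ i : Fin 1, Fin.cast (rfl : n + 1 = n + 1) (Fin.natAdd n i) = Fin.last n :=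
    fun i => Fin.ext (by simp)
  simp only [tmul, e, PiLp.single_apply, hv, c0, c1]
  split_ifs <;> simp_all

/-- The vacuum vector is separating for `𝒜_X`: it is cyclic for the right shifts, with which
`𝒜_X` commutes. -/
theorem eq_zero_of_apply_vacuum_eq_zero (T : X.alg)
    (hT : (T : X.Fock →L[ℂ] X.Fock) X.vacuum = 0) : T = 0 := by
  have hsingle : ∀ n (x : X.fiber n), (T : X.Fock →L[ℂ] X.Fock) (lp.single 2 n x) = 0 := by
    intro n
    induction n with
    | zero =>
      intro x
      have : lp.single 2 0 x = (x : TPow d 0) (fun i => i.elim0) • X.vacuum := by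
        rw [vacuum, ← lp.single_smul]
        congr 1
        ext w
        simp [Subsingleton.elim w (fun i => i.elim0)]
      rw [this, map_smul, hT, smul_zero]
    | succ n ih =>
      intro x
      have hR : ∀ (j : Fin d) (u : X.fiber n), (T : X.Fock →L[ℂ] X.Fock)
          (lp.single 2 (n + 1) (X.rightMul j n u)) = 0 := by
        intro j u
        obtain ⟨h0, h⟩ := (X.isRightShift_single j n u).map T
        refine lp.ext (funext fun m => ?_)
        rcases m with _ | m
        · exact h0
        · rw [h, ih]
          exact map_zero _
      have hx : x = ∑ w : Fin (n + 1) → Fin d, (x : TPow d (n + 1)) w •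
          X.rightMul (w (Fin.last n)) n ((X.fiber n).orthogonalProjectionOnto
              (EuclideanSpace.single (fun i => w (Fin.castSucc i)) 1)) := by
        simp only [rightMul_apply, proj_tmul_proj_left]
        conv_lhs => rw [← Submodule.orthogonalProjectionOnto_mem_subspace_eq_self x]
        conv_lhs => rw [sum_single_tmul_e n (x : TPow d (n + 1))]
        rw [map_sum]
        simp only [map_smul]
      have hlin : ∀ y, (T : X.Fock →L[ℂ] X.Fock) (lp.single 2 (n + 1) y) =
          ((T : X.Fock →L[ℂ] X.Fock).comp
            (lp.singleContinuousLinearMap ℂ (fun n => X.fiber n) 2 (n + 1))) y := fun _ => rfl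
      rw [hlin, hx, map_sum]
      refine Finset.sum_eq_zero fun w _ => ?_
      rw [map_smul, ← hlin, hR, smul_zero]
  refine Subtype.ext (ContinuousLinearMap.ext fun x => ?_)
  have h := (lp.hasSum_single (by norm_num) x).mapL (T : X.Fock →L[ℂ] X.Fock)
  simp only [hsingle] at h
  exact h.unique hasSum_zero

theorem eq_of_apply_vacuum_eq {S T : X.alg}
    (h : (S : X.Fock →L[ℂ] X.Fock) X.vacuum = (T : X.Fock →L[ℂ] X.Fock) X.vacuum) : S = T := by
  rw [← sub_eq_zero]
  refine X.eq_zero_of_apply_vacuum_eq_zero _ ?_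
  change (S : X.Fock →L[ℂ] X.Fock) X.vacuum - (T : X.Fock →L[ℂ] X.Fock) X.vacuum = 0
  rw [h, sub_self]

/-- The vector `e_j ∈ E = X(1)`, seen in the Fock space. -/
def basisVec (j : Fin d) : X.Fock := lp.single 2 1 ⟨e j, X.fiber_one ▸ trivial⟩

theorem norm_basisVec (j : Fin d) : ‖X.basisVec j‖ = 1 := by
  rw [basisVec, lp.norm_single (by norm_num)]
  simp [e]

theorem shift_single (i : Fin d) (n : ℕ) (x : X.fiber n) :
    X.shift i (lp.single 2 n x) = lp.single 2 (n + 1) ((X.fiber (n + 1)).orthogonalProjectionOnto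
      (tmul (Nat.add_comm 1 n) (e i) (x : TPow d n))) := by
  refine lp.ext (funext fun m => ?_)
  rcases m with _ | m
  · rw [shift_apply_zero, lp.single_apply_ne _ _ _ (Nat.succ_ne_zero n).symm]
  · rw [shift_apply_succ]
    by_cases hmn : m = n
    · subst hmn
      rw [lp.single_apply_self, lp.single_apply_self]
    · rw [lp.single_apply_ne _ _ _ hmn, lp.single_apply_ne _ _ _ (by omega)]
      have : tmul (Nat.add_comm 1 m) (e i) ((0 : X.fiber m) : TPow d m) = 0 := by
        ext w; simp [tmul]
      rw [this, map_zero]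

theorem shift_vacuum (j : Fin d) : X.shift j X.vacuum = X.basisVec j := by
  rw [vacuum, shift_single, basisVec]
  congr 1
  have h : tmul (Nat.add_comm 1 0) (e j) (EuclideanSpace.single (fun i => i.elim0) 1 : TPow d 0) =
      e j := by
    ext w
    simp [tmul, e, PiLp.single_apply, Subsingleton.elim _ (fun i : Fin 0 => (i.elim0 : Fin d))]
  rw [h]
  exact Submodule.orthogonalProjectionOnto_mem_subspace_eq_self
    (⟨e j, X.fiber_one ▸ trivial⟩ : X.fiber 1)

theorem shift_shift_vacuum (i j : Fin d) : X.shift i (X.shift j X.vacuum) =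
    lp.single 2 2 ((X.fiber 2).orthogonalProjectionOnto (tmul (Nat.one_add 1) (e i) (e j))) := by
  rw [shift_vacuum, basisVec, shift_single]

end StandardSubproductSystem

variable {d : ℕ} {q : Matrix (Fin d) (Fin d) ℂ}

/-! ### The relations of the `q`-shift -/

theorem inner_e (i j : Fin d) : inner ℂ (e i) (e j) = if i = j then 1 else 0 := by
  have : (fun _ : Fin 1 => i) = (fun _ => j) ↔ i = j := ⟨fun h => congrFun h 0, fun h => by rw [h]⟩
  rw [e, e, EuclideanSpace.inner_single_left, PiLp.single_apply]
  simp [this]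

theorem qSystem_fiber (n : ℕ) : (qSystem q).fiber n = maxFiber (qFiberTwo q) n := rfl

theorem qSystem_fiber_two : (qSystem q).fiber 2 = qFiberTwo q := by
  rw [qSystem_fiber, maxFiber]

theorem mem_qFiberTwo {x : TPow d 2} : x ∈ qFiberTwo q ↔ ∀ i j, i ≠ j →
    inner ℂ (tmul (Nat.one_add 1) (e i) (e j) -
      q i j • tmul (Nat.one_add 1) (e j) (e i) : TPow d 2) x = 0 := by
  rw [qFiberTwo, Submodule.mem_orthogonal]
  refine ⟨fun h i j hij => h _ (Submodule.subset_span ⟨i, j, hij, rfl⟩), fun h u hu => ?_⟩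
  induction hu using Submodule.span_induction with
  | mem z hz => obtain ⟨i, j, hij, rfl⟩ := hz; exact h i j hij
  | zero => simp
  | add u v _ _ hu hv => rw [inner_add_left, hu, hv, add_zero]
  | smul c u _ hu => rw [inner_smul_left, hu, mul_zero]

theorem qShift_apply (i : Fin d) :
    (qShift q i : (qSystem q).Fock →L[ℂ] (qSystem q).Fock) = (qSystem q).shift i := rfl

/-- The commutation relation of the `q`-shift, checked on the separating vacuum vector. -/
theorem qShift_mul_qShift {i j : Fin d} (hij : i ≠ j) :
    qShift q i * qShift q j = q i j • (qShift q j * qShift q i) := by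
  refine (qSystem q).eq_of_apply_vacuum_eq ?_
  rw [StandardSubproductSystem.smul_apply, StandardSubproductSystem.mul_apply,
    StandardSubproductSystem.mul_apply, qShift_apply, qShift_apply,
    StandardSubproductSystem.shift_shift_vacuum, StandardSubproductSystem.shift_shift_vacuum,
    ← lp.single_smul]
  congr 1
  rw [← map_smul]
  refine orthogonalProjectionOnto_eq_of_inner _ fun z hz => ?_
  rw [qSystem_fiber_two] at hz
  rw [← inner_conj_symm, mem_qFiberTwo.1 hz i j hij, map_zero]

theorem qShift_mul_qShift_ne_zero (hq : Admissible q) {i j : Fin d} (hij : i ≠ j) :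
    qShift q i * qShift q j ≠ 0 := by
  intro h
  have h1 : ((qShift q i * qShift q j : qAlg q) : (qSystem q).Fock →L[ℂ] (qSystem q).Fock)
      (qSystem q).vacuum 2 = 0 := by rw [h]; rfl
  rw [StandardSubproductSystem.mul_apply, qShift_apply, qShift_apply,
    StandardSubproductSystem.shift_shift_vacuum, lp.single_apply_self,
    Submodule.orthogonalProjectionOnto_eq_zero_iff, qSystem_fiber_two] at h1
  -- The vector `e_i ⊗ e_j + conj(q_ji) e_j ⊗ e_i` of `X(2)` is not orthogonal to `e_i ⊗ e_j`.
  have h2 : tmul (Nat.one_add 1) (e i) (e j) + (starRingEnd ℂ) (q j i) •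
      tmul (Nat.one_add 1) (e j) (e i) ∈ qFiberTwo q := by
    rw [mem_qFiberTwo]
    intro k l hkl
    simp only [inner_sub_left, inner_add_right, inner_smul_left, inner_smul_right, inner_tmul,
      inner_e]
    have hc : (starRingEnd ℂ) (q i j) * (starRingEnd ℂ) (q j i) = 1 := by
      rw [← map_mul, (hq.2 i j hij).2, inv_mul_cancel₀ (hq.2 j i hij.symm).1, map_one]
    by_cases hki : k = i
    · subst hki
      by_cases hlj : l = j
      · subst hlj
        simp only [hij, hij.symm, if_true, if_false]
        linear_combination -hc
      · simp [hlj, hij]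
    · by_cases hkj : k = j
      · subst hkj
        by_cases hli : l = i
        · subst hli; simp [hij, hij.symm]
        · simp [hki, hli]
      · simp [hki, hkj]
  have h3 := (Submodule.mem_orthogonal _ _).1 h1 _ h2
  rw [inner_add_left, inner_smul_left, inner_tmul, inner_tmul, inner_e, inner_e, inner_e] at h3
  simp [hij.symm] at h3

/-! ### The power series attached to a coordinate axis -/

theorem tmul_pure {m n k : ℕ} (h : m + n = k) (i : Fin d) :
    (EuclideanSpace.single (fun _ => i) 1 : TPow d k) =
      tmul h (EuclideanSpace.single (fun _ => i) 1) (EuclideanSpace.single (fun _ => i) 1) := by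
  subst h
  ext w
  have hw : w = (fun _ => i) ↔ (fun a => w (Fin.castAdd n a)) = (fun _ => i) ∧
      (fun a => w (Fin.natAdd m a)) = (fun _ => i) := by
    refine ⟨by rintro rfl; simp, fun ⟨h1, h2⟩ => funext fun a => ?_⟩
    induction a using Fin.addCases with
    | left a => exact congrFun h1 a
    | right a => exact congrFun h2 a
  simp only [tmul, PiLp.single_apply, Fin.cast_refl, hw]
  split_ifs <;> simp_all

theorem pure_mem_fiber (k : Fin d) (n : ℕ) :
    (EuclideanSpace.single (fun _ => k) 1 : TPow d n) ∈ (qSystem q).fiber n := by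
  rw [qSystem_fiber]
  induction n using Nat.strong_induction_on with
  | _ n ih =>
    match n with
    | 0 => rw [maxFiber]; trivial
    | 1 => rw [maxFiber]; trivial
    | 2 =>
      rw [maxFiber, mem_qFiberTwo]
      intro i j hij
      have h2 : (EuclideanSpace.single (fun _ => k) 1 : TPow d 2) =
        tmul (Nat.one_add 1) (e k) (e k) := tmul_pure _ k
      rw [h2, inner_sub_left, inner_smul_left, inner_tmul, inner_tmul, inner_e, inner_e]
      by_cases hik : i = k
      · subst hik; simp [hij.symm]
      · simp [hik]
    | n + 3 =>
      rw [maxFiber]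
      simp only [Submodule.mem_iInf]
      intro a b h
      exact Submodule.subset_span ⟨_, ih _ (by omega), _, ih _ (by omega), tmul_pure h k⟩

/-- The power series `∑ ⟨e_k^{⊗n}, x⟩ zⁿ` of a vector `x` of the Fock space along the `k`-th
coordinate axis. -/
def axisSeries (k : Fin d) (x : (qSystem q).Fock) : PowerSeries ℂ :=
  PowerSeries.mk fun n => (x n : TPow d n) fun _ => k

theorem coeff_axisSeries (k : Fin d) (x : (qSystem q).Fock) (n : ℕ) :
    PowerSeries.coeff n (axisSeries k x) = (x n : TPow d n) fun _ => k :=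
  PowerSeries.coeff_mk _ _

theorem norm_coeff_axisSeries_le (k : Fin d) (x : (qSystem q).Fock) (n : ℕ) :
    ‖PowerSeries.coeff n (axisSeries k x)‖ ≤ ‖x‖ := by
  rw [coeff_axisSeries]
  exact (PiLp.norm_apply_le _ _).trans (lp.norm_apply_le_norm two_ne_zero x n)

theorem axisSeries_vacuum (k : Fin d) : axisSeries k (qSystem q).vacuum = 1 := by
  ext n
  rw [coeff_axisSeries, PowerSeries.coeff_one]
  rcases n with _ | n
  · rw [StandardSubproductSystem.vacuum_apply_zero, if_pos rfl]
  · rw [StandardSubproductSystem.vacuum_apply_succ, if_neg (Nat.succ_ne_zero n)]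
    rfl

theorem axisSeries_add (k : Fin d) (x y : (qSystem q).Fock) :
    axisSeries k (x + y) = axisSeries k x + axisSeries k y := rfl

theorem axisSeries_smul (k : Fin d) (c : ℂ) (x : (qSystem q).Fock) :
    axisSeries k (c • x) = c • axisSeries k x := rfl

/-- Since `e_k^{⊗n} ∈ X_q(n)`, the shift `S_k` multiplies the series along the `k`-th axis by the
variable, and the other shifts annihilate it. -/
theorem axisSeries_shift (i k : Fin d) (x : (qSystem q).Fock) :
    axisSeries k ((qSystem q).shift i x) =
      if i = k then PowerSeries.X * axisSeries k x else 0 := by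
  have key : ∀ n, PowerSeries.coeff (n + 1) (axisSeries k ((qSystem q).shift i x)) =
      if i = k then (x n : TPow d n) (fun _ => k) else 0 := by
    intro n
    have h1 : ∀ y : TPow d (n + 1), y (fun _ => k) =
        inner ℂ (EuclideanSpace.single (fun _ => k) 1) y := fun y => by
      rw [EuclideanSpace.inner_single_left, map_one, one_mul]
    have h2 := Submodule.inner_orthogonalProjectionOnto_eq_of_mem_left
      (K := (qSystem q).fiber (n + 1)) ⟨_, pure_mem_fiber k (n + 1)⟩
      (tmul (Nat.add_comm 1 n) (e i) (x n : TPow d n))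
    rw [coeff_axisSeries, StandardSubproductSystem.shift_apply_succ, h1]
    refine h2.trans ?_
    rw [← h1]
    have h3 : (fun _ : Fin 1 => k) = (fun _ => i) ↔ i = k :=
      ⟨fun h => (congrFun h 0).symm, fun h => by rw [h]⟩
    simp [tmul, e, PiLp.single_apply, h3]
  ext n
  rcases n with _ | n
  · rw [coeff_axisSeries, StandardSubproductSystem.shift_apply_zero]
    split_ifs <;> simp
  · rw [key]
    split_ifs with h
    · rw [PowerSeries.coeff_succ_X_mul, coeff_axisSeries]
    · simp

theorem continuous_coeff_axisSeries (k : Fin d) (x : (qSystem q).Fock) (n : ℕ) :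
    Continuous fun T : qAlg q => PowerSeries.coeff n
      (axisSeries k ((T : (qSystem q).Fock →L[ℂ] (qSystem q).Fock) x)) := by
  simp only [coeff_axisSeries]
  exact (qSystem q).continuous_coeff x n _

theorem axisSeries_apply (k : Fin d) (T : qAlg q) : ∀ x : (qSystem q).Fock,
    axisSeries k ((T : (qSystem q).Fock →L[ℂ] (qSystem q).Fock) x) =
      axisSeries k ((T : (qSystem q).Fock →L[ℂ] (qSystem q).Fock) (qSystem q).vacuum) *
        axisSeries k x := by
  refine (qSystem q).alg_induction (P := fun T => ∀ x : (qSystem q).Fock,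
    axisSeries k ((T : (qSystem q).Fock →L[ℂ] (qSystem q).Fock) x) =
      axisSeries k ((T : (qSystem q).Fock →L[ℂ] (qSystem q).Fock) (qSystem q).vacuum) *
        axisSeries k x) ?_ ?_ ?_ ?_ ?_ T
  · have h : IsClosed (⋂ x : (qSystem q).Fock, ⋂ n : ℕ, {T : qAlg q | PowerSeries.coeff n
        (axisSeries k ((T : (qSystem q).Fock →L[ℂ] (qSystem q).Fock) x)) =
      ∑ p ∈ Finset.HasAntidiagonal.antidiagonal n, PowerSeries.coeff p.1
        (axisSeries k ((T : (qSystem q).Fock →L[ℂ] (qSystem q).Fock) (qSystem q).vacuum)) *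
        PowerSeries.coeff p.2 (axisSeries k x)}) :=
      isClosed_iInter fun x => isClosed_iInter fun n =>
        isClosed_eq (continuous_coeff_axisSeries k x n) (continuous_finsetSum _ fun p _ =>
          (continuous_coeff_axisSeries k _ p.1).mul continuous_const)
    convert h using 1
    ext T
    simp only [Set.mem_ofPred_eq, Set.mem_iInter, PowerSeries.ext_iff, PowerSeries.coeff_mul]
  · intro i x
    change axisSeries k ((qSystem q).shift i x) =
      axisSeries k ((qSystem q).shift i (qSystem q).vacuum) * _
    rw [axisSeries_shift, axisSeries_shift, axisSeries_vacuum]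
    split_ifs <;> simp
  · intro c x
    rw [StandardSubproductSystem.algebraMap_apply, StandardSubproductSystem.algebraMap_apply,
      axisSeries_smul, axisSeries_smul, axisSeries_vacuum, smul_mul_assoc, one_mul]
  · intro S T hS hT x
    rw [StandardSubproductSystem.add_apply, StandardSubproductSystem.add_apply, axisSeries_add,
      axisSeries_add, hS, hT, add_mul]
  · intro S T hS hT x
    rw [StandardSubproductSystem.mul_apply, StandardSubproductSystem.mul_apply, hS, hT,
      hS ((T : (qSystem q).Fock →L[ℂ] (qSystem q).Fock) _), mul_assoc]

/-- Restriction of `𝒜_q` to the `k`-th coordinate axis: the homomorphism to formal power series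
that sends `S_k` to the variable and the other shifts to zero. -/
def axisHom (k : Fin d) : qAlg q →ₐ[ℂ] PowerSeries ℂ :=
  AlgHom.ofLinearMap
    { toFun := fun T =>
        axisSeries k ((T : (qSystem q).Fock →L[ℂ] (qSystem q).Fock) (qSystem q).vacuum)
      map_add' := fun S T => by rw [StandardSubproductSystem.add_apply, axisSeries_add]
      map_smul' := fun c T => by
        rw [StandardSubproductSystem.smul_apply, axisSeries_smul, RingHom.id_apply] }
    (axisSeries_vacuum k)
    (fun S T => by
      change axisSeries k (((S * T : qAlg q) : (qSystem q).Fock →L[ℂ] (qSystem q).Fock) _) =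
        axisSeries k _ * axisSeries k _
      rw [StandardSubproductSystem.mul_apply, axisSeries_apply])

theorem axisHom_apply (k : Fin d) (T : qAlg q) : axisHom k T =
    axisSeries k ((T : (qSystem q).Fock →L[ℂ] (qSystem q).Fock) (qSystem q).vacuum) := rfl

theorem axisHom_qShift (i k : Fin d) :
    axisHom k (qShift q i) = if i = k then PowerSeries.X else 0 := by
  rw [axisHom_apply, qShift_apply, axisSeries_shift, axisSeries_vacuum, mul_one]

theorem continuous_coeff_axisHom (k : Fin d) (n : ℕ) :
    Continuous fun T : qAlg q => PowerSeries.coeff n (axisHom k T) :=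
  continuous_coeff_axisSeries k _ n

theorem continuous_constantCoeff_axisHom (k : Fin d) :
    Continuous fun T : qAlg q => PowerSeries.constantCoeff (axisHom k T) := by
  simpa only [PowerSeries.coeff_zero_eq_constantCoeff] using continuous_coeff_axisHom k 0

theorem norm_coeff_axisHom_le (k : Fin d) (T : qAlg q) (n : ℕ) :
    ‖PowerSeries.coeff n (axisHom k T)‖ ≤ ‖T‖ := by
  refine (norm_coeff_axisSeries_le k _ n).trans ((ContinuousLinearMap.le_opNorm _ _).trans ?_)
  rw [(qSystem q).norm_vacuum, mul_one]
  rfl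

/-- The constant coefficient is the vacuum state, which is the same on all axes. -/
theorem constantCoeff_axisHom (k l : Fin d) (T : qAlg q) :
    PowerSeries.constantCoeff (axisHom k T) = PowerSeries.constantCoeff (axisHom l T) := by
  rw [← PowerSeries.coeff_zero_eq_constantCoeff_apply,
    ← PowerSeries.coeff_zero_eq_constantCoeff_apply, axisHom_apply, axisHom_apply,
    coeff_axisSeries, coeff_axisSeries]
  exact congrArg _ (Subsingleton.elim _ _)

/-! ### Characters -/

theorem summable_norm_coeff_mul_pow (k : Fin d) {z : ℂ} (hz : ‖z‖ < 1) (T : qAlg q) :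
    Summable fun n => ‖PowerSeries.coeff n (axisHom k T) * z ^ n‖ := by
  refine Summable.of_nonneg_of_le (fun _ => norm_nonneg _) (fun n => ?_)
    ((summable_geometric_of_lt_one (norm_nonneg z) hz).mul_left ‖T‖)
  rw [norm_mul, norm_pow]
  exact mul_le_mul_of_nonneg_right (norm_coeff_axisHom_le k T n) (by positivity)

/-- The character of `𝒜_q` given by evaluation at the point `z e_k`, `|z| < 1`. -/
def axisEval (k : Fin d) (z : ℂ) (hz : ‖z‖ < 1) : qAlg q →ₐ[ℂ] ℂ :=
  AlgHom.ofLinearMap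
    { toFun := fun T => ∑' n, PowerSeries.coeff n (axisHom k T) * z ^ n
      map_add' := fun S T => by
        rw [← (summable_norm_coeff_mul_pow k hz S).of_norm.tsum_add
          (summable_norm_coeff_mul_pow k hz T).of_norm]
        simp only [map_add, add_mul]
      map_smul' := fun c T => by
        simp only [map_smul, smul_eq_mul, RingHom.id_apply, mul_assoc, tsum_mul_left] }
    (by
      change ∑' n, PowerSeries.coeff n (axisHom k 1) * z ^ n = 1
      rw [tsum_eq_single 0, map_one, PowerSeries.coeff_one, if_pos rfl, pow_zero, mul_one]
      intro n hn
      rw [map_one, PowerSeries.coeff_one, if_neg hn, zero_mul])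
    (fun S T => by
      change ∑' n, PowerSeries.coeff n (axisHom k (S * T)) * z ^ n =
        (∑' n, PowerSeries.coeff n (axisHom k S) * z ^ n) *
          ∑' n, PowerSeries.coeff n (axisHom k T) * z ^ n
      rw [tsum_mul_tsum_eq_tsum_sum_antidiagonal_of_summable_norm
        (summable_norm_coeff_mul_pow k hz S) (summable_norm_coeff_mul_pow k hz T)]
      refine tsum_congr fun n => ?_
      rw [map_mul, PowerSeries.coeff_mul, Finset.sum_mul]
      refine Finset.sum_congr rfl fun p hp => ?_
      rw [← Finset.HasAntidiagonal.mem_antidiagonal.1 hp, pow_add]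
      ring)

theorem axisEval_apply (k : Fin d) (z : ℂ) (hz : ‖z‖ < 1) (T : qAlg q) :
    axisEval k z hz T = ∑' n, PowerSeries.coeff n (axisHom k T) * z ^ n := rfl

theorem axisEval_qShift (i k : Fin d) (z : ℂ) (hz : ‖z‖ < 1) :
    axisEval k z hz (qShift q i) = if i = k then z else 0 := by
  rw [axisEval_apply, axisHom_qShift]
  split_ifs with h
  · rw [tsum_eq_single 1]
    · simp
    · intro n hn
      rw [PowerSeries.coeff_X, if_neg hn, zero_mul]
  · simp

instance : CompleteSpace (qAlg q) :=
  (Subalgebra.isClosed_topologicalClosure _).completeSpace_coe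

theorem norm_qShift_le (i : Fin d) : ‖qShift q i‖ ≤ 1 := (qSystem q).norm_shift_le i

theorem norm_algHom_apply_le (χ : qAlg q →ₐ[ℂ] ℂ) (T : qAlg q) : ‖χ T‖ ≤ ‖T‖ := by
  refine (AlgHom.norm_apply_le_self_mul_norm_one χ T).trans ?_
  have h : ‖(1 : qAlg q)‖ ≤ 1 := ContinuousLinearMap.norm_id_le
  exact mul_le_of_le_one_right (norm_nonneg _) h

theorem lipschitzWith_algHom (χ : qAlg q →ₐ[ℂ] ℂ) : LipschitzWith 1 χ :=
  LipschitzWith.of_dist_le_mul fun S T => by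
    rw [dist_eq_norm, dist_eq_norm, ← map_sub, NNReal.coe_one, one_mul]
    exact norm_algHom_apply_le χ _

/-- Homomorphisms to commutative domains kill all but one of the shifts when `q_ij ≠ 1`. -/
theorem algHom_mul_eq_zero {B : Type*} [CommRing B] [Algebra ℂ B] {i j : Fin d} (hij : i ≠ j)
    (hq : q i j ≠ 1) (Θ : qAlg q →ₐ[ℂ] B) : Θ (qShift q i) * Θ (qShift q j) = 0 := by
  have h := congrArg Θ (qShift_mul_qShift (q := q) hij)
  rw [map_smul, map_mul, map_mul, mul_comm (Θ (qShift q j))] at h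
  have h1 : (1 - q i j) • (Θ (qShift q i) * Θ (qShift q j)) = 0 := by
    rw [sub_smul, one_smul, sub_eq_zero]
    exact h
  exact (smul_eq_zero.1 h1).resolve_left (sub_ne_zero.2 (Ne.symm hq))

/-- A character that kills all shifts but `S_k` is a pointwise limit of evaluations at points of
the open unit disc of the `k`-th axis. -/
theorem tendsto_axisEval (χ : qAlg q →ₐ[ℂ] ℂ) (k : Fin d) (hχ : ∀ i, i ≠ k → χ (qShift q i) = 0)
    (z : ℕ → ℂ) (hz : ∀ n, ‖z n‖ < 1) (hlim : Tendsto z atTop (𝓝 (χ (qShift q k))))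
    (T : qAlg q) : Tendsto (fun n => axisEval k (z n) (hz n) T) atTop (𝓝 (χ T)) := by
  refine (qSystem q).alg_induction
    (P := fun T => Tendsto (fun n => axisEval k (z n) (hz n) T) atTop (𝓝 (χ T))) ?_ ?_ ?_ ?_ ?_ T
  · exact ((LipschitzWith.uniformEquicontinuous (fun n T => axisEval k (z n) (hz n) T) 1
      fun n => lipschitzWith_algHom _).equicontinuous).isClosed_setOfPred_tendsto
        (lipschitzWith_algHom χ).continuous
  · intro i
    change Tendsto (fun n => axisEval k (z n) (hz n) (qShift q i)) atTop (𝓝 (χ (qShift q i)))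
    simp only [axisEval_qShift]
    by_cases hi : i = k
    · subst hi
      simpa using hlim
    · simp [hi, hχ i hi]
  · intro c
    simp only [AlgHom.commutes]
    exact tendsto_const_nhds
  · intro S T hS hT
    simp only [map_add]
    exact hS.add hT
  · intro S T hS hT
    simp only [map_mul]
    exact hS.mul hT

/-- If all `q_ij ≠ 1`, an element of `𝒜_q` that vanishes on all coordinate axes is killed by every
character: the character space is the union of the closed unit discs in the axes. -/
theorem character_eq_zero [Nonempty (Fin d)] (hq : ∀ i j, i ≠ j → q i j ≠ 1)
    (χ : qAlg q →ₐ[ℂ] ℂ) (T : qAlg q) (hT : ∀ k, axisHom k T = 0) : χ T = 0 := by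
  obtain ⟨k, hk⟩ : ∃ k, ∀ i, i ≠ k → χ (qShift q i) = 0 := by
    by_cases h : ∃ k, χ (qShift q k) ≠ 0
    · obtain ⟨k, hk⟩ := h
      exact ⟨k, fun i hi =>
        (mul_eq_zero.1 (algHom_mul_eq_zero hi (hq i k hi) χ)).resolve_right hk⟩
    · push Not at h
      exact ⟨Classical.arbitrary _, fun i _ => h i⟩
  have hw : ‖χ (qShift q k)‖ ≤ 1 := (norm_algHom_apply_le χ _).trans (norm_qShift_le k)
  -- Approach the point `χ(S_k)` of the closed disc radially from inside.
  let t : ℕ → ℝ := fun n => 1 - 1 / ((n : ℝ) + 1)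
  have ht : Tendsto t atTop (𝓝 1) := by
    have h := (tendsto_const_nhds (x := (1 : ℝ))).sub
      (tendsto_one_div_add_atTop_nhds_zero_nat (𝕜 := ℝ))
    rwa [sub_zero] at h
  have ht0 : ∀ n, 0 ≤ t n := fun n => by
    have : 1 / ((n : ℝ) + 1) ≤ 1 := by
      rw [div_le_one (by positivity)]
      linarith [n.cast_nonneg (α := ℝ)]
    exact sub_nonneg.2 this
  have ht1 : ∀ n, t n < 1 := fun n => sub_lt_self _ (by positivity)
  have hz : ∀ n, ‖(t n : ℂ) * χ (qShift q k)‖ < 1 := fun n => by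
    rw [norm_mul, Complex.norm_real, Real.norm_of_nonneg (ht0 n)]
    exact (mul_le_of_le_one_right (ht0 n) hw).trans_lt (ht1 n)
  have hlim : Tendsto (fun n => (t n : ℂ) * χ (qShift q k)) atTop (𝓝 (χ (qShift q k))) := by
    simpa using ((Complex.continuous_ofReal.tendsto 1).comp ht).mul_const (χ (qShift q k))
  have h := tendsto_axisEval χ k hk _ hz hlim T
  simp only [axisEval_apply, hT k, map_zero, zero_mul, tsum_zero] at h
  exact tendsto_nhds_unique h tendsto_const_nhds

/-! ### Rigidity of isometric isomorphisms -/

variable {r : Matrix (Fin d) (Fin d) ℂ}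

theorem axisHom_algEquiv_mul_eq_zero {i j : Fin d} (hij : i ≠ j) (hq : q i j ≠ 1)
    (φ : qAlg q ≃ₐ[ℂ] qAlg r) (k : Fin d) :
    axisHom k (φ (qShift q i)) * axisHom k (φ (qShift q j)) = 0 :=
  algHom_mul_eq_zero hij hq ((axisHom k).comp φ.toAlgHom)

/-- For `d ≠ 1` an algebra isomorphism preserves the vacuum state. Otherwise some `φ(S_i)` is
nonzero at the common point `0` of the axes, so it vanishes on no axis; then every other `φ(S_j)`
vanishes on all axes and is killed by all characters, although a character separates `S_j`
from `0`. -/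
theorem constantCoeff_algEquiv_qShift (hd : d ≠ 1) (hq : ∀ i j, i ≠ j → q i j ≠ 1)
    (hr : ∀ i j, i ≠ j → r i j ≠ 1) (φ : qAlg q ≃ₐ[ℂ] qAlg r) (i k : Fin d) :
    PowerSeries.constantCoeff (axisHom k (φ (qShift q i))) = 0 := by
  by_contra hne
  obtain ⟨j, hji⟩ : ∃ j, j ≠ i := by
    have : Nontrivial (Fin d) := Fin.nontrivial_iff_two_le.2 (by have := i.pos; omega)
    exact exists_ne i
  have hj : ∀ l, axisHom l (φ (qShift q j)) = 0 := by
    intro l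
    refine (mul_eq_zero.1 (axisHom_algEquiv_mul_eq_zero hji (hq j i hji) φ l)).resolve_right
      fun h => hne ?_
    rw [constantCoeff_axisHom k l, h, map_zero]
  have hz : ‖(1 / 2 : ℂ)‖ < 1 := by norm_num
  have : Nonempty (Fin d) := ⟨i⟩
  have h := character_eq_zero hr
    ((axisEval j (1 / 2) hz).comp φ.symm.toAlgHom) (φ (qShift q j)) hj
  have h' : axisEval j (1 / 2) hz (φ.symm (φ (qShift q j))) = 0 := h
  rw [φ.symm_apply_apply, axisEval_qShift, if_pos rfl] at h'
  norm_num at h'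

/-- A continuous isomorphism that preserves the vacuum state acts linearly on the degree one
coefficients, which are derivations at the vacuum state. -/
theorem coeff_algEquiv (φ : qAlg q ≃ₐ[ℂ] qAlg r) (hφ : Continuous φ)
    (hvac : ∀ i k, PowerSeries.constantCoeff (axisHom k (φ (qShift q i))) = 0) (k : Fin d) (T : qAlg q) :
    PowerSeries.constantCoeff (axisHom k (φ T)) = PowerSeries.constantCoeff (axisHom k T) ∧
    PowerSeries.coeff 1 (axisHom k (φ T)) = ∑ i, PowerSeries.coeff 1 (axisHom k (φ (qShift q i))) *
      PowerSeries.coeff 1 (axisHom i T) := by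
  refine (qSystem q).alg_induction (P := fun T => PowerSeries.constantCoeff (axisHom k (φ T)) =
      PowerSeries.constantCoeff (axisHom k T) ∧ PowerSeries.coeff 1 (axisHom k (φ T)) =
      ∑ i, PowerSeries.coeff 1 (axisHom k (φ (qShift q i))) *
        PowerSeries.coeff 1 (axisHom i T)) ?_ ?_ ?_ ?_ ?_ T
  · exact (isClosed_eq ((continuous_constantCoeff_axisHom k).comp hφ)
      (continuous_constantCoeff_axisHom k)).inter
      (isClosed_eq ((continuous_coeff_axisHom k 1).comp hφ) (continuous_finsetSum _ fun i _ =>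
        continuous_const.mul (continuous_coeff_axisHom i 1)))
  · intro j
    change PowerSeries.constantCoeff (axisHom k (φ (qShift q j))) =
      PowerSeries.constantCoeff (axisHom k (qShift q j)) ∧
      PowerSeries.coeff 1 (axisHom k (φ (qShift q j))) =
      ∑ i, PowerSeries.coeff 1 (axisHom k (φ (qShift q i))) *
        PowerSeries.coeff 1 (axisHom i (qShift q j))
    simp only [axisHom_qShift]
    refine ⟨?_, ?_⟩
    · rw [hvac]
      split_ifs <;> simp
    · rw [Finset.sum_eq_single j]
      · simp
      · intro i _ hij
        simp [hij.symm]
      · simp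
  · intro c
    simp
  · rintro S T ⟨hS0, hS1⟩ ⟨hT0, hT1⟩
    simp only [map_add, hS0, hS1, hT0, hT1, mul_add, Finset.sum_add_distrib, and_self]
  · rintro S T ⟨hS0, hS1⟩ ⟨hT0, hT1⟩
    simp only [map_mul, PowerSeries.coeff_one_mul, hS0, hS1, hT0, hT1, true_and, mul_add,
      Finset.sum_add_distrib, Finset.sum_mul]
    refine congrArg₂ _ (Finset.sum_congr rfl fun i _ => ?_) (Finset.sum_congr rfl fun i _ => ?_)
    · rw [constantCoeff_axisHom i k]; ring
    · rw [constantCoeff_axisHom i k]; ring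

/-- An element of norm at most one whose degree one coefficient along the `k`-th axis is unimodular
is a multiple of `S_k`: the Cauchy-Schwarz inequality is an equality. -/
theorem eq_smul_qShift_of_norm_coeff_one {T : qAlg q} (hT : ‖T‖ ≤ 1) {k : Fin d}
    (hk : ‖PowerSeries.coeff 1 (axisHom k T)‖ = 1) :
    T = PowerSeries.coeff 1 (axisHom k T) • qShift q k := by
  refine (qSystem q).eq_of_apply_vacuum_eq ?_
  rw [StandardSubproductSystem.smul_apply, qShift_apply, StandardSubproductSystem.shift_vacuum]
  set y : (qSystem q).Fock :=
    (T : (qSystem q).Fock →L[ℂ] (qSystem q).Fock) (qSystem q).vacuum with hy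
  set c : ℂ := PowerSeries.coeff 1 (axisHom k T) with hc
  have hyn : ‖y‖ ≤ 1 := by
    refine (ContinuousLinearMap.le_opNorm _ _).trans ?_
    rw [(qSystem q).norm_vacuum, mul_one]
    exact hT
  have hin : inner ℂ ((qSystem q).basisVec k) y = c := by
    rw [StandardSubproductSystem.basisVec, lp.inner_single_left, hc, axisHom_apply, coeff_axisSeries,
      Submodule.coe_inner, e, EuclideanSpace.inner_single_left, map_one, one_mul]
  rw [← sub_eq_zero, ← norm_eq_zero, ← sq_eq_zero_iff]
  refine le_antisymm ?_ (sq_nonneg _)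
  rw [norm_sub_sq (𝕜 := ℂ), norm_smul, (qSystem q).norm_basisVec, mul_one, hk, inner_smul_right,
    ← inner_conj_symm, hin, Complex.mul_conj, Complex.normSq_eq_norm_sq, hk]
  norm_num
  nlinarith [norm_nonneg y]

theorem norm_algEquiv_apply (φ : qAlg q ≃ₐ[ℂ] qAlg r) (hφ : Isometry φ) (T : qAlg q) :
    ‖φ T‖ = ‖T‖ := by
  have h := hφ.dist_eq T 0
  rwa [map_zero, dist_zero_right, dist_zero_right] at h

/-- The linear part of an isometric isomorphism, a matrix whose inverse is the linear part of the
inverse isomorphism, has a unimodular entry in each row: by the `q`-relations the row has only one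
nonzero entry, and the entries of both matrices have modulus at most one. -/
theorem exists_norm_coeff_one_eq_one (hd : d ≠ 1) (hq : ∀ i j, i ≠ j → q i j ≠ 1)
    (hr : ∀ i j, i ≠ j → r i j ≠ 1) (φ : qAlg q ≃ₐ[ℂ] qAlg r) (hφ : Isometry φ) (k : Fin d) :
    ∃ i, ‖PowerSeries.coeff 1 (axisHom k (φ (qShift q i)))‖ = 1 := by
  have hu : ∀ i, ‖φ (qShift q i)‖ ≤ 1 := fun i =>
    (norm_algEquiv_apply φ hφ _).trans_le (norm_qShift_le i)
  have hv : ‖φ.symm (qShift r k)‖ ≤ 1 := by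
    rw [← norm_algEquiv_apply φ hφ, φ.apply_symm_apply]
    exact norm_qShift_le k
  have h1 := (coeff_algEquiv φ hφ.continuous
    (fun i k => constantCoeff_algEquiv_qShift hd hq hr φ i k) k (φ.symm (qShift r k))).2
  rw [φ.apply_symm_apply, axisHom_qShift, if_pos rfl, PowerSeries.coeff_one_X] at h1
  obtain ⟨i, -, hi⟩ := Finset.exists_ne_zero_of_sum_ne_zero (h1.symm.trans_ne one_ne_zero)
  have hne : axisHom k (φ (qShift q i)) ≠ 0 := fun h => by
    rw [h, map_zero, zero_mul] at hi
    exact hi rfl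
  rw [Finset.sum_eq_single i] at h1
  · refine ⟨i, le_antisymm ((norm_coeff_axisHom_le k _ 1).trans (hu i)) ?_⟩
    have h3 := congrArg norm h1
    rw [norm_one, norm_mul] at h3
    rw [h3]
    exact mul_le_of_le_one_right (norm_nonneg _) ((norm_coeff_axisHom_le i _ 1).trans hv)
  · intro j _ hji
    have h3 : axisHom k (φ (qShift q j)) = 0 :=
      (mul_eq_zero.1 (axisHom_algEquiv_mul_eq_zero hji (hq j i hji) φ k)).resolve_right hne
    exact mul_eq_zero_of_left ((congrArg _ h3).trans (map_zero _)) _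
  · exact fun h => absurd (Finset.mem_univ i) h

/-- A homomorphism that maps one `q`-commuting pair to multiples of another one matches the
parameters. -/
theorem eq_of_commutation {A B : Type*} [Ring A] [Algebra ℂ A] [Ring B] [Algebra ℂ B]
    (φ : A →ₐ[ℂ] B) {s t : A} {u v : B} {a b x y : ℂ} (ha : a ≠ 0) (hb : b ≠ 0)
    (hs : φ s = a • u) (ht : φ t = b • v) (hst : s * t = x • (t * s)) (huv : u * v = y • (v * u))
    (hne : v * u ≠ 0) : y = x := by
  have h := congrArg φ hst
  rw [map_smul, map_mul, map_mul, hs, ht, smul_mul_smul_comm, smul_mul_smul_comm, huv, smul_smul,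
    smul_smul] at h
  have h1 : (a * b * (y - x)) • (v * u) = 0 := by
    have h2 : a * b * (y - x) = a * b * y - x * (b * a) := by ring
    rw [h2, sub_smul, h, sub_self]
  exact sub_eq_zero.1 ((mul_eq_zero.1 ((smul_eq_zero.1 h1).resolve_right hne)).resolve_left
    (mul_ne_zero ha hb))

/-- For `d ≠ 1` and `q_ij, r_ij ≠ 1`, isometric isomorphisms permute the shifts up to unimodular
factors. -/
theorem exists_perm_of_isometry (hd : d ≠ 1) (hqa : Admissible q) (hra : Admissible r)
    (hq : ∀ i j, i ≠ j → q i j ≠ 1) (hr : ∀ i j, i ≠ j → r i j ≠ 1)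
    (φ : qAlg q ≃ₐ[ℂ] qAlg r) (hφ : Isometry φ) :
    ∃ (σ : Equiv.Perm (Fin d)) (c : Fin d → ℂ), (∀ i j, r (σ i) (σ j) = q i j) ∧
      (∀ i, ‖c i‖ = 1) ∧ ∀ i, φ (qShift q i) = c i • qShift r (σ i) := by
  choose τ hτ using exists_norm_coeff_one_eq_one hd hq hr φ hφ
  have hφτ : ∀ k, φ (qShift q (τ k)) =
      PowerSeries.coeff 1 (axisHom k (φ (qShift q (τ k)))) • qShift r k := fun k =>
    eq_smul_qShift_of_norm_coeff_one
      ((norm_algEquiv_apply φ hφ _).trans_le (norm_qShift_le _)) (hτ k)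
  have hinj : Function.Injective τ := by
    intro k l hkl
    by_contra hne
    have h1 := hτ l
    rw [← hkl, hφτ k, map_smul, axisHom_qShift, if_neg hne, smul_zero, map_zero, norm_zero] at h1
    exact zero_ne_one h1
  let ρ : Equiv.Perm (Fin d) := Equiv.ofBijective τ (Finite.injective_iff_bijective.1 hinj)
  have hρ : ∀ i, τ (ρ.symm i) = i := fun i => ρ.apply_symm_apply i
  have hc : ∀ i, ‖PowerSeries.coeff 1 (axisHom (ρ.symm i) (φ (qShift q i)))‖ = 1 := fun i => by
    have h := hτ (ρ.symm i)
    rwa [hρ] at h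
  have hφρ : ∀ i, φ (qShift q i) =
      PowerSeries.coeff 1 (axisHom (ρ.symm i) (φ (qShift q i))) • qShift r (ρ.symm i) := fun i => by
    have h := hφτ (ρ.symm i)
    rwa [hρ] at h
  refine ⟨ρ.symm, _, fun i j => ?_, hc, hφρ⟩
  by_cases hij : i = j
  · subst hij
    rw [hra.1, hqa.1]
  · have hij' := ρ.symm.injective.ne hij
    exact eq_of_commutation φ.toAlgHom (norm_ne_zero_iff.1 (by rw [hc]; exact one_ne_zero))
      (norm_ne_zero_iff.1 (by rw [hc]; exact one_ne_zero)) (hφρ i) (hφρ j)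
      (qShift_mul_qShift hij) (qShift_mul_qShift hij')
      (qShift_mul_qShift_ne_zero hra hij'.symm)

/-! ### Spatial isomorphisms -/

namespace StandardSubproductSystem

variable {X Y : StandardSubproductSystem d}

/-- The isometric map of Fock spaces given by isometric maps of the fibers. -/
def fockMap (f : ∀ n, X.fiber n →ₗᵢ[ℂ] Y.fiber n) : X.Fock →ₗᵢ[ℂ] Y.Fock where
  toFun x := ⟨fun n => f n (x n), memℓp_gen (by
    have hx := (lp.memℓp x).summable (by norm_num)
    simpa only [LinearIsometry.norm_map] using hx)⟩
  map_add' x y := lp.ext (funext fun n => map_add (f n) (x n) (y n))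
  map_smul' c x := lp.ext (funext fun n => map_smul (f n) c (x n))
  norm_map' x := by
    rw [← sq_eq_sq₀ (norm_nonneg _) (norm_nonneg _), norm_sq_eq_tsum, norm_sq_eq_tsum]
    exact tsum_congr fun n => congrArg (· ^ 2) ((f n).norm_map (x n))

/-- The unitary map of Fock spaces given by unitary maps of the fibers. -/
def fockEquiv (f : ∀ n, X.fiber n ≃ₗᵢ[ℂ] Y.fiber n) : X.Fock ≃ₗᵢ[ℂ] Y.Fock :=
  LinearIsometryEquiv.ofSurjective (fockMap fun n => (f n).toLinearIsometry) fun y =>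
    ⟨fockMap (fun n => (f n).symm.toLinearIsometry) y,
      lp.ext (funext fun n => (f n).apply_symm_apply (y n))⟩

theorem fockEquiv_apply (f : ∀ n, X.fiber n ≃ₗᵢ[ℂ] Y.fiber n) (x : X.Fock) (n : ℕ) :
    fockEquiv f x n = f n (x n) := rfl

/-- Conjugation `T ↦ V T V⁻¹` by a unitary map of Fock spaces. -/
def conj (V : X.Fock ≃ₗᵢ[ℂ] Y.Fock) (T : X.Fock →L[ℂ] X.Fock) : Y.Fock →L[ℂ] Y.Fock :=
  (V.toContinuousLinearEquiv : X.Fock →L[ℂ] Y.Fock).comp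
    (T.comp (V.symm.toContinuousLinearEquiv : Y.Fock →L[ℂ] X.Fock))

theorem conj_apply (V : X.Fock ≃ₗᵢ[ℂ] Y.Fock) (T : X.Fock →L[ℂ] X.Fock) (y : Y.Fock) :
    conj V T y = V (T (V.symm y)) := rfl

theorem norm_conj_le (V : X.Fock ≃ₗᵢ[ℂ] Y.Fock) (T : X.Fock →L[ℂ] X.Fock) :
    ‖conj V T‖ ≤ ‖T‖ := by
  refine ContinuousLinearMap.opNorm_le_bound _ (norm_nonneg T) fun y => ?_
  rw [conj_apply, V.norm_map, ← V.symm.norm_map y]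
  exact T.le_opNorm _

theorem conj_symm_conj (V : X.Fock ≃ₗᵢ[ℂ] Y.Fock) (T : X.Fock →L[ℂ] X.Fock) :
    conj V.symm (conj V T) = T := by
  ext1 x
  rw [conj_apply, conj_apply, V.symm_symm, V.symm_apply_apply, V.symm_apply_apply]

theorem norm_conj (V : X.Fock ≃ₗᵢ[ℂ] Y.Fock) (T : X.Fock →L[ℂ] X.Fock) : ‖conj V T‖ = ‖T‖ := by
  refine le_antisymm (norm_conj_le V T) ?_
  have h := norm_conj_le V.symm (conj V T)
  rwa [conj_symm_conj] at h

theorem conj_add (V : X.Fock ≃ₗᵢ[ℂ] Y.Fock) (S T : X.Fock →L[ℂ] X.Fock) :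
    conj V (S + T) = conj V S + conj V T :=
  ContinuousLinearMap.ext fun y => map_add V (S (V.symm y)) (T (V.symm y))

theorem conj_mul (V : X.Fock ≃ₗᵢ[ℂ] Y.Fock) (S T : X.Fock →L[ℂ] X.Fock) :
    conj V (S * T) = conj V S * conj V T :=
  ContinuousLinearMap.ext fun y =>
    congrArg (fun z => V (S z)) (V.symm_apply_apply (T (V.symm y))).symm

theorem conj_algebraMap (V : X.Fock ≃ₗᵢ[ℂ] Y.Fock) (c : ℂ) :
    conj V (algebraMap ℂ (X.Fock →L[ℂ] X.Fock) c) = algebraMap ℂ (Y.Fock →L[ℂ] Y.Fock) c :=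
  ContinuousLinearMap.ext fun y =>
    (map_smul V c (V.symm y)).trans (congrArg (c • ·) (V.apply_symm_apply y))

theorem conj_sub (V : X.Fock ≃ₗᵢ[ℂ] Y.Fock) (S T : X.Fock →L[ℂ] X.Fock) :
    conj V (S - T) = conj V S - conj V T :=
  ContinuousLinearMap.ext fun y => map_sub V (S (V.symm y)) (T (V.symm y))

theorem continuous_conj (V : X.Fock ≃ₗᵢ[ℂ] Y.Fock) : Continuous (conj V) := by
  refine (Isometry.of_dist_eq fun S T => ?_).continuous
  rw [dist_eq_norm, dist_eq_norm, ← conj_sub, norm_conj]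

theorem conj_mem_alg (V : X.Fock ≃ₗᵢ[ℂ] Y.Fock) (hV : ∀ i, conj V (X.shift i) ∈ Y.alg)
    (T : X.alg) : conj V T ∈ Y.alg := by
  refine X.alg_induction (P := fun T => conj V T ∈ Y.alg) ?_ hV ?_ ?_ ?_ T
  · exact (Subalgebra.isClosed_topologicalClosure _).preimage
      ((continuous_conj V).comp continuous_subtype_val)
  · intro c
    exact (conj_algebraMap V c).symm ▸ Y.alg.algebraMap_mem c
  · intro S T hS hT
    exact (conj_add V S T).symm ▸ Y.alg.add_mem hS hT
  · intro S T hS hT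
    exact (conj_mul V S T).symm ▸ Y.alg.mul_mem hS hT

/-- A unitary map of Fock spaces that conjugates the shifts of both sides into the other algebra
induces an isomorphism of the algebras. -/
def conjAlgEquiv (V : X.Fock ≃ₗᵢ[ℂ] Y.Fock) (hV : ∀ i, conj V (X.shift i) ∈ Y.alg)
    (hV' : ∀ i, conj V.symm (Y.shift i) ∈ X.alg) : X.alg ≃ₐ[ℂ] Y.alg where
  toFun T := ⟨conj V T, conj_mem_alg V hV T⟩
  invFun T := ⟨conj V.symm T, conj_mem_alg V.symm hV' T⟩
  left_inv T := Subtype.ext (conj_symm_conj V T)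
  right_inv T := Subtype.ext (conj_symm_conj V.symm T)
  map_add' S T := Subtype.ext (conj_add V S T)
  map_mul' S T := Subtype.ext (conj_mul V S T)
  commutes' c := Subtype.ext (conj_algebraMap V c)

theorem isometry_conjAlgEquiv (V : X.Fock ≃ₗᵢ[ℂ] Y.Fock) (hV : ∀ i, conj V (X.shift i) ∈ Y.alg)
    (hV' : ∀ i, conj V.symm (Y.shift i) ∈ X.alg) : Isometry (conjAlgEquiv V hV hV') :=
  AddMonoidHomClass.isometry_of_norm _ fun T => norm_conj V T

end StandardSubproductSystem

/-! ### Permutation and rescaling of the coordinates -/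

/-- The unitary operator on `E^{⊗n}` that is the `n`-th tensor power of the monomial unitary
`e_i ↦ c_i e_{σ(i)}`. -/
def wordMap (σ : Equiv.Perm (Fin d)) (c : Fin d → ℂ) (hc : ∀ i, ‖c i‖ = 1) (n : ℕ) :
    TPow d n →ₗᵢ[ℂ] TPow d n where
  toFun x := WithLp.toLp 2 fun w => (∏ i, c (σ.symm (w i))) * x fun i => σ.symm (w i)
  map_add' x y := by ext w; simp [mul_add]
  map_smul' a x := by ext w; simp; ring
  norm_map' x := by
    rw [← sq_eq_sq₀ (norm_nonneg _) (norm_nonneg _), EuclideanSpace.norm_sq_eq,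
      EuclideanSpace.norm_sq_eq, ← (Equiv.arrowCongr (Equiv.refl (Fin n)) σ).sum_comp]
    refine Finset.sum_congr rfl fun w _ => ?_
    simp [hc]

variable {σ : Equiv.Perm (Fin d)} {c : Fin d → ℂ} {hc : ∀ i, ‖c i‖ = 1}

theorem wordMap_apply (n : ℕ) (x : TPow d n) (w : Fin n → Fin d) :
    wordMap σ c hc n x w = (∏ i, c (σ.symm (w i))) * x fun i => σ.symm (w i) := rfl

theorem wordMap_tmul {m n k : ℕ} (h : m + n = k) (x : TPow d m) (y : TPow d n) :
    wordMap σ c hc k (tmul h x y) = tmul h (wordMap σ c hc m x) (wordMap σ c hc n y) := by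
  subst h
  ext w
  rw [wordMap_apply, Fin.prod_univ_add]
  simp only [tmul, wordMap_apply, Fin.cast_refl, id_eq]
  ring

theorem wordMap_e (i : Fin d) : wordMap σ c hc 1 (e i) = c i • e (σ i) := by
  ext w
  have h1 : (fun a => σ.symm (w a)) = (fun _ => i) ↔ w = fun _ => σ i := by
    simp only [funext_iff, Equiv.symm_apply_eq]
  rw [wordMap_apply, Fin.prod_univ_one, e, e, PiLp.smul_apply, PiLp.single_apply,
    PiLp.single_apply]
  by_cases h : w = fun _ => σ i
  · rw [if_pos h, if_pos (h1.2 h), h, Equiv.symm_apply_apply, smul_eq_mul]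
  · rw [if_neg h, if_neg (mt h1.1 h), mul_zero, smul_zero]

theorem wordMap_wordMap {c' : Fin d → ℂ} {hc' : ∀ i, ‖c' i‖ = 1} (hcc : ∀ i, c i * c' (σ i) = 1)
    (n : ℕ) (x : TPow d n) : wordMap σ.symm c' hc' n (wordMap σ c hc n x) = x := by
  ext w
  rw [wordMap_apply, wordMap_apply, ← mul_assoc, ← Finset.prod_mul_distrib]
  simp only [Equiv.symm_symm, Equiv.symm_apply_apply]
  rw [Finset.prod_eq_one fun i _ => by rw [mul_comm, hcc], one_mul]

theorem wordMap_mem_tensorSub {m n k : ℕ} {h : m + n = k} {A A' : Submodule ℂ (TPow d m)}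
    {B B' : Submodule ℂ (TPow d n)} (hA : ∀ x ∈ A, wordMap σ c hc m x ∈ A')
    (hB : ∀ y ∈ B, wordMap σ c hc n y ∈ B') {z : TPow d k} (hz : z ∈ tensorSub h A B) :
    wordMap σ c hc k z ∈ tensorSub h A' B' := by
  have hle : tensorSub h A B ≤ (tensorSub h A' B').comap (wordMap σ c hc k).toLinearMap := by
    refine Submodule.span_le.2 ?_
    rintro _ ⟨x, hx, y, hy, rfl⟩
    exact Submodule.subset_span ⟨_, hA x hx, _, hB y hy, wordMap_tmul h x y⟩
  exact hle hz

theorem wordMap_mem_fiber (hσ : ∀ i j, r (σ i) (σ j) = q i j) (n : ℕ) (x : TPow d n)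
    (hx : x ∈ (qSystem q).fiber n) : wordMap σ c hc n x ∈ (qSystem r).fiber n := by
  rw [qSystem_fiber] at hx ⊢
  induction n using Nat.strong_induction_on with
  | _ n ih =>
    match n with
    | 0 => rw [maxFiber]; trivial
    | 1 => rw [maxFiber]; trivial
    | 2 =>
      rw [maxFiber, mem_qFiberTwo] at hx ⊢
      intro k l hkl
      obtain ⟨i, rfl⟩ := σ.surjective k
      obtain ⟨j, rfl⟩ := σ.surjective l
      have h1 : wordMap σ c hc 2 (tmul (Nat.one_add 1) (e i) (e j) -
          q i j • tmul (Nat.one_add 1) (e j) (e i)) = (c i * c j) •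
          (tmul (Nat.one_add 1) (e (σ i)) (e (σ j)) -
            r (σ i) (σ j) • tmul (Nat.one_add 1) (e (σ j)) (e (σ i))) := by
        rw [map_sub, map_smul, wordMap_tmul, wordMap_tmul, wordMap_e, wordMap_e, tmul_smul,
          smul_tmul, tmul_smul, smul_tmul, hσ]
        module
      have h2 := hx i j (ne_of_apply_ne σ hkl)
      rw [← (wordMap σ c hc 2).inner_map_map, h1, inner_smul_left] at h2
      refine (mul_eq_zero.1 h2).resolve_left ?_
      rw [← ne_eq, ← norm_ne_zero_iff, RCLike.norm_conj, norm_mul, hc, hc, one_mul]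
      exact one_ne_zero
    | n + 3 =>
      rw [maxFiber] at hx ⊢
      simp only [Submodule.mem_iInf] at hx ⊢
      intro a b h
      exact wordMap_mem_tensorSub (ih _ (by omega)) (ih _ (by omega)) (hx a b h)

variable (σ c hc) in
/-- The isometric map `X_q(n) → X_r(n)` given by a permutation that matches `q` with `r`. -/
def fiberMap (hσ : ∀ i j, r (σ i) (σ j) = q i j) (n : ℕ) :
    (qSystem q).fiber n →ₗᵢ[ℂ] (qSystem r).fiber n where
  toLinearMap := ((wordMap σ c hc n).toLinearMap.comp
    ((qSystem q).fiber n).subtype).codRestrict ((qSystem r).fiber n)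
      fun x => wordMap_mem_fiber (hc := hc) hσ n x x.2
  norm_map' x := (wordMap σ c hc n).norm_map (x : TPow d n)

theorem coe_fiberMap (hσ : ∀ i j, r (σ i) (σ j) = q i j) (n : ℕ) (x : (qSystem q).fiber n) :
    (fiberMap σ c hc hσ n x : TPow d n) = wordMap σ c hc n (x : TPow d n) := rfl

theorem fiberMap_surjective (hσ : ∀ i j, r (σ i) (σ j) = q i j) (n : ℕ) :
    Function.Surjective (fiberMap σ c hc hσ n) := by
  intro y
  have hc' : ∀ i, ‖(c (σ.symm i))⁻¹‖ = 1 := fun i => by rw [norm_inv, hc, inv_one]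
  have hne : ∀ i, c i ≠ 0 := fun i => norm_ne_zero_iff.1 (by rw [hc]; exact one_ne_zero)
  have hσ' : ∀ i j, q (σ.symm i) (σ.symm j) = r i j := fun i j => by
    rw [← hσ, σ.apply_symm_apply, σ.apply_symm_apply]
  refine ⟨fiberMap σ.symm (fun i => (c (σ.symm i))⁻¹) hc' hσ' n y, Subtype.ext ?_⟩
  rw [coe_fiberMap, coe_fiberMap]
  have h := wordMap_wordMap (σ := σ.symm) (c := fun i => (c (σ.symm i))⁻¹) (hc := hc')
    (c' := c) (hc' := hc) (fun i => inv_mul_cancel₀ (hne _)) n (y : TPow d n)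
  rwa [σ.symm_symm] at h

variable (σ c hc) in
/-- The unitary map `X_q(n) → X_r(n)` given by a permutation that matches `q` with `r`. -/
def fiberEquiv (hσ : ∀ i j, r (σ i) (σ j) = q i j) (n : ℕ) :
    (qSystem q).fiber n ≃ₗᵢ[ℂ] (qSystem r).fiber n :=
  LinearIsometryEquiv.ofSurjective (fiberMap σ c hc hσ n) (fiberMap_surjective hσ n)

theorem coe_fiberEquiv (hσ : ∀ i j, r (σ i) (σ j) = q i j) (n : ℕ) (x : (qSystem q).fiber n) :
    (fiberEquiv σ c hc hσ n x : TPow d n) = wordMap σ c hc n (x : TPow d n) := rfl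

/-- The unitary maps of the fibers intertwine the orthogonal projections onto them. -/
theorem proj_wordMap (hσ : ∀ i j, r (σ i) (σ j) = q i j) (n : ℕ) (x : TPow d n) :
    ((qSystem r).fiber n).orthogonalProjectionOnto (wordMap σ c hc n x) =
      fiberEquiv σ c hc hσ n (((qSystem q).fiber n).orthogonalProjectionOnto x) := by
  rw [← Submodule.orthogonalProjectionOnto_mem_subspace_eq_self
    (fiberEquiv σ c hc hσ n (((qSystem q).fiber n).orthogonalProjectionOnto x))]
  refine orthogonalProjectionOnto_eq_of_inner _ fun z hz => ?_
  obtain ⟨y, hy⟩ := (fiberEquiv σ c hc hσ n).surjective ⟨z, hz⟩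
  have hyz : wordMap σ c hc n y = z := congrArg Subtype.val hy
  rw [coe_fiberEquiv, ← map_sub, ← hyz, LinearIsometry.inner_map_map]
  exact (Submodule.mem_orthogonal _ _).1
    (Submodule.sub_starProjection_mem_orthogonal (K := (qSystem q).fiber n) x) _ y.2

theorem fockEquiv_shift (hσ : ∀ i j, r (σ i) (σ j) = q i j) (i : Fin d) (x : (qSystem q).Fock) :
    StandardSubproductSystem.fockEquiv (fiberEquiv σ c hc hσ) ((qSystem q).shift i x) =
      c i • (qSystem r).shift (σ i)
        (StandardSubproductSystem.fockEquiv (fiberEquiv σ c hc hσ) x) := by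
  refine lp.ext (funext fun n => ?_)
  rw [StandardSubproductSystem.fockEquiv_apply]
  change _ = c i • (qSystem r).shift (σ i) _ n
  rcases n with _ | n
  · rw [StandardSubproductSystem.shift_apply_zero, StandardSubproductSystem.shift_apply_zero,
      map_zero, smul_zero]
  · rw [StandardSubproductSystem.shift_apply_succ, StandardSubproductSystem.shift_apply_succ,
      StandardSubproductSystem.fockEquiv_apply, ← proj_wordMap, coe_fiberEquiv, wordMap_tmul,
      wordMap_e, smul_tmul, map_smul]

/-- A permutation that matches the parameters and unimodular weights induce an isometric
isomorphism. -/
theorem exists_isometry_of_perm (hσ : ∀ i j, r (σ i) (σ j) = q i j) (hc : ∀ i, ‖c i‖ = 1) :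
    ∃ φ : qAlg q ≃ₐ[ℂ] qAlg r, Isometry φ ∧ ∀ i, φ (qShift q i) = c i • qShift r (σ i) := by
  let V := StandardSubproductSystem.fockEquiv (fiberEquiv σ c hc hσ)
  have h1 : ∀ i, StandardSubproductSystem.conj V ((qSystem q).shift i) =
      c i • (qSystem r).shift (σ i) := fun i => by
    ext1 y
    rw [StandardSubproductSystem.conj_apply]
    refine (fockEquiv_shift hσ i (V.symm y)).trans ?_
    rw [V.apply_symm_apply y]
    rfl
  have h2 : ∀ j, StandardSubproductSystem.conj V.symm ((qSystem r).shift j) =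
      (c (σ.symm j))⁻¹ • (qSystem q).shift (σ.symm j) := fun j => by
    have hne : c (σ.symm j) ≠ 0 := norm_ne_zero_iff.1 (by rw [hc]; exact one_ne_zero)
    ext1 x
    rw [StandardSubproductSystem.conj_apply, V.symm_symm]
    refine V.injective ((V.apply_symm_apply _).trans ?_)
    have h3 := fockEquiv_shift (hc := hc) hσ (σ.symm j) x
    rw [σ.apply_symm_apply] at h3
    refine Eq.symm ((map_smul V (c (σ.symm j))⁻¹ _).trans ?_)
    refine (congrArg ((c (σ.symm j))⁻¹ • ·) h3).trans ?_
    rw [smul_smul, inv_mul_cancel₀ hne, one_smul]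
  have hV : ∀ i, StandardSubproductSystem.conj V ((qSystem q).shift i) ∈ qAlg r := fun i =>
    (h1 i).symm ▸ (qAlg r).smul_mem ((qSystem r).shift_mem_alg _) _
  have hV' : ∀ j, StandardSubproductSystem.conj V.symm ((qSystem r).shift j) ∈ qAlg q := fun j =>
    (h2 j).symm ▸ (qAlg q).smul_mem ((qSystem q).shift_mem_alg _) _
  exact ⟨StandardSubproductSystem.conjAlgEquiv V hV hV',
    StandardSubproductSystem.isometry_conjAlgEquiv V hV hV', fun i => Subtype.ext (h1 i)⟩

/-- Continuous homomorphisms of `𝒜_q` are determined on the shifts. -/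
theorem algEquiv_ext {φ ψ : qAlg q ≃ₐ[ℂ] qAlg r} (hφ : Continuous φ) (hψ : Continuous ψ)
    (h : ∀ i, φ (qShift q i) = ψ (qShift q i)) : φ = ψ := by
  refine AlgEquiv.ext fun T => ?_
  refine (qSystem q).alg_induction (P := fun T => φ T = ψ T) (isClosed_eq hφ hψ) h ?_ ?_ ?_ T
  · intro a
    exact (φ.commutes a).trans (ψ.commutes a).symm
  · intro S T hS hT
    exact (map_add φ S T).trans ((congrArg₂ (· + ·) hS hT).trans (map_add ψ S T).symm)
  · intro S T hS hT
    exact (map_mul φ S T).trans ((congrArg₂ (· * ·) hS hT).trans (map_mul ψ S T).symm)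

/-! ### Permutation matrices and the case of two generators -/

theorem permU_inv (σ : Equiv.Perm (Fin d)) : (permU σ)⁻¹ = (permU σ).transpose := by
  refine Matrix.inv_eq_right_inv (Matrix.ext fun i j => ?_)
  simp only [Matrix.mul_apply, permU, Matrix.transpose_apply, Matrix.of_apply, ite_mul, one_mul,
    zero_mul, Matrix.one_apply, ← σ.symm_apply_eq]
  rw [Finset.sum_ite_eq, if_pos (Finset.mem_univ _)]
  simp [eq_comm]

theorem eq_permU_conj_iff (σ : Equiv.Perm (Fin d)) :
    r = permU σ * q * (permU σ)⁻¹ ↔ ∀ i j, r (σ i) (σ j) = q i j := by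
  have h : ∀ i j, (permU σ * q * (permU σ)⁻¹) (σ i) (σ j) = q i j := fun i j => by
    rw [permU_inv]
    simp [Matrix.mul_apply, permU]
  refine ⟨fun hr i j => by rw [hr, h], fun hr => Matrix.ext fun k l => ?_⟩
  rw [← σ.apply_symm_apply k, ← σ.apply_symm_apply l, hr, h]

theorem commute_of_eq_one (hq : ∀ i j, i ≠ j → q i j = 1) (S T : qAlg q) : Commute S T := by
  have h1 : ∀ i, ∀ T : qAlg q, Commute (qShift q i) T := fun i T => by
    refine (qSystem q).alg_induction (P := fun T => Commute (qShift q i) T)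
      (isClosed_eq (continuous_const.mul continuous_id) (continuous_id.mul continuous_const))
      (fun j => ?_) (fun a => Algebra.commute_algebraMap_right a _)
      (fun _ _ hS hT => hS.add_right hT) (fun _ _ hS hT => hS.mul_right hT) T
    by_cases hij : i = j
    · subst hij
      exact Commute.refl _
    · refine (qShift_mul_qShift hij).trans ?_
      rw [hq i j hij, one_smul]
      rfl
  exact (qSystem q).alg_induction (P := fun S => Commute S T)
    (isClosed_eq (continuous_id.mul continuous_const) (continuous_const.mul continuous_id))
    (fun i => h1 i T) (fun a => Algebra.commute_algebraMap_left a _)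
    (fun _ _ hS hT => hS.add_left hT) (fun _ _ hS hT => hS.mul_left hT) S

/-- An algebra `𝒜_r` isomorphic to a commutative `𝒜_q` is commutative, so `r_ij = 1` by the
`q`-relations and `S_j S_i ≠ 0`. -/
theorem eq_one_of_algEquiv (hq : ∀ i j, i ≠ j → q i j = 1) (hr : Admissible r)
    (φ : qAlg q ≃ₐ[ℂ] qAlg r) {i j : Fin d} (hij : i ≠ j) : r i j = 1 := by
  have h : qShift r i * qShift r j = qShift r j * qShift r i := by
    have h1 := (commute_of_eq_one hq (φ.symm (qShift r i)) (φ.symm (qShift r j))).map φ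
    rwa [φ.apply_symm_apply, φ.apply_symm_apply] at h1
  refine eq_of_commutation (AlgHom.id ℂ (qAlg r)) (a := 1) (b := 1) one_ne_zero one_ne_zero
    (one_smul ℂ _).symm (one_smul ℂ _).symm (h.trans (one_smul ℂ _).symm) (qShift_mul_qShift hij)
    (qShift_mul_qShift_ne_zero hr hij.symm)

theorem admissible_two {a : ℂ} (ha : a ≠ 0) : Admissible !![0, a; a⁻¹, 0] := by
  refine ⟨fun i => ?_, fun i j hij => ?_⟩
  · fin_cases i <;> rfl
  · fin_cases i <;> fin_cases j <;> simp_all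

theorem two_ne_one {a : ℂ} (ha : a ≠ 1) (i j : Fin 2) (hij : i ≠ j) :
    (!![0, a; a⁻¹, 0] : Matrix (Fin 2) (Fin 2) ℂ) i j ≠ 1 := by
  fin_cases i <;> fin_cases j <;> simp_all

theorem exists_perm_two_iff {a b : ℂ} : (∃ σ : Equiv.Perm (Fin 2), ∀ i j,
    (!![0, b; b⁻¹, 0] : Matrix (Fin 2) (Fin 2) ℂ) (σ i) (σ j) =
      (!![0, a; a⁻¹, 0] : Matrix (Fin 2) (Fin 2) ℂ) i j) ↔ b = a ∨ b = a⁻¹ := by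
  constructor
  · rintro ⟨σ, h⟩
    have h01 := h 0 1
    have hne : σ 0 ≠ σ 1 := σ.injective.ne Fin.zero_ne_one
    have hval : ∀ k : Fin 2, k = 0 ∨ k = 1 := fun k => by fin_cases k <;> simp
    rcases hval (σ 0) with h0 | h0 <;> rcases hval (σ 1) with h1 | h1 <;> rw [h0, h1] at hne h01
    · exact absurd rfl hne
    · exact Or.inl h01
    · right
      have h2 : b⁻¹ = a := h01
      rw [← h2, inv_inv]
    · exact absurd rfl hne
  · rintro (rfl | rfl)
    · exact ⟨1, fun _ _ => rfl⟩
    · refine ⟨Equiv.swap 0 1, fun i j => ?_⟩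
      fin_cases i <;> fin_cases j <;> simp

theorem isometricallyIsomorphic_iff (hd : d ≠ 1) (hqa : Admissible q) (hra : Admissible r)
    (hq : ∀ i j, i ≠ j → q i j ≠ 1) (hr : ∀ i j, i ≠ j → r i j ≠ 1) :
    IsometricallyIsomorphic q r ↔ ∃ σ : Equiv.Perm (Fin d), ∀ i j, r (σ i) (σ j) = q i j := by
  constructor
  · rintro ⟨φ, hφ⟩
    obtain ⟨σ, -, hσ, -⟩ := exists_perm_of_isometry hd hqa hra hq hr φ hφ
    exact ⟨σ, hσ⟩
  · rintro ⟨σ, hσ⟩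
    obtain ⟨φ, hφ, -⟩ := exists_isometry_of_perm (c := fun _ => 1) hσ fun _ => norm_one
    exact ⟨φ, hφ⟩

theorem isometricallyIsomorphic_two_iff {a b : ℂ} (ha : a ≠ 0) (hb : b ≠ 0) :
    IsometricallyIsomorphic !![0, a; a⁻¹, 0] !![0, b; b⁻¹, 0] ↔ b = a ∨ b = a⁻¹ := by
  have hone : ∀ i j : Fin 2, i ≠ j →
      (!![0, 1; 1⁻¹, 0] : Matrix (Fin 2) (Fin 2) ℂ) i j = 1 := fun i j hij => by
    fin_cases i <;> fin_cases j <;> simp_all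
  rw [← exists_perm_two_iff]
  constructor
  · intro h
    by_cases ha1 : a = 1
    · obtain ⟨φ, -⟩ := h
      subst ha1
      have hb1 : b = 1 := eq_one_of_algEquiv hone (admissible_two hb) φ Fin.zero_ne_one
      exact exists_perm_two_iff.2 (Or.inl hb1)
    by_cases hb1 : b = 1
    · obtain ⟨φ, -⟩ := h
      subst hb1
      exact absurd (eq_one_of_algEquiv hone (admissible_two ha) φ.symm Fin.zero_ne_one) ha1
    exact (isometricallyIsomorphic_iff (by norm_num) (admissible_two ha) (admissible_two hb)
      (two_ne_one ha1) (two_ne_one hb1)).1 h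
  · rintro ⟨σ, hσ⟩
    obtain ⟨φ, hφ, -⟩ := exists_isometry_of_perm (c := fun _ => 1) hσ fun _ => norm_one
    exact ⟨φ, hφ⟩

end QCommuting

end

open QCommuting in
theorem mainTheorem10 :
    (∀ (d : ℕ) (q r : Matrix (Fin d) (Fin d) ℂ), Admissible q → Admissible r →
      (∀ i j, i ≠ j → q i j ≠ 1) → (∀ i j, i ≠ j → r i j ≠ 1) →
      (IsometricallyIsomorphic q r ↔
        ∃ σ : Equiv.Perm (Fin d), r = permU σ * q * (permU σ)⁻¹) ∧
      (d ≠ 1 → ∀ φ : qAlg q ≃ₐ[ℂ] qAlg r, Isometry φ →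
        ∃ (σ : Equiv.Perm (Fin d)) (c : Fin d → ℂ), r = permU σ * q * (permU σ)⁻¹ ∧
          (∀ i, ‖c i‖ = 1) ∧ ∀ i, φ (qShift q i) = c i • qShift r (σ i)) ∧
      (∀ (σ : Equiv.Perm (Fin d)) (c : Fin d → ℂ), r = permU σ * q * (permU σ)⁻¹ →
        (∀ i, ‖c i‖ = 1) →
        ∃! φ : qAlg q ≃ₐ[ℂ] qAlg r,
          Isometry φ ∧ ∀ i, φ (qShift q i) = c i • qShift r (σ i))) ∧
    (∀ q r : ℂ, q ≠ 0 → r ≠ 0 →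
      (IsometricallyIsomorphic !![0, q; q⁻¹, 0] !![0, r; r⁻¹, 0] ↔ r = q ∨ r = q⁻¹)) := by
  refine ⟨fun d q r hqa hra hq hr => ⟨?_, ?_, ?_⟩, fun a b => isometricallyIsomorphic_two_iff⟩
  · simp only [eq_permU_conj_iff]
    by_cases hd : d = 1
    · -- For `d = 1` both matrices vanish.
      subst hd
      have h : ∀ i j, r ((1 : Equiv.Perm (Fin 1)) i) ((1 : Equiv.Perm (Fin 1)) j) = q i j :=
        fun i j => by
          rw [Subsingleton.elim j i, hqa.1, hra.1]
      obtain ⟨φ, hφ, -⟩ := exists_isometry_of_perm (c := fun _ => 1) h fun _ => norm_one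
      exact iff_of_true ⟨φ, hφ⟩ ⟨1, h⟩
    · exact isometricallyIsomorphic_iff hd hqa hra hq hr
  · intro hd φ hφ
    obtain ⟨σ, c, hσ, hc, h⟩ := exists_perm_of_isometry hd hqa hra hq hr φ hφ
    exact ⟨σ, c, (eq_permU_conj_iff σ).2 hσ, hc, h⟩
  · intro σ c hσ hc
    obtain ⟨φ, hφ, h⟩ := exists_isometry_of_perm ((eq_permU_conj_iff σ).1 hσ) hc
    refine ⟨φ, ⟨hφ, h⟩, fun ψ hψ => ?_⟩
    exact algEquiv_ext hψ.1.continuous hφ.continuous fun i => (hψ.2 i).trans (h i).symm
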